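/- For $a,b\in\mathbb R$ let $F_{a,b}:\mathbb R^2\to\mathbb R^2$, $F_{a,b}(x,y)=(|x|-y+a,\;x-|y|+b)$. For $a<0$, an \emph{invariant graph} of $F_{a,b}$ is a nonempty compact graph $\Gamma\subset\mathbb R^2$ with straight edges (a finite union of closed segments, possibly degenerate to points) such that $F_{a,b}(\Gamma)\subset\Gamma$ and, for some finite (possibly empty) set $E$ of periodic points of $F_{a,b}$, for every $\mathbf x\in\mathbb R^2$ there is $n\ge 0$ with $F_{a,b}^n(\mathbf x)\in\Gamma\cup E$. Write $c=-b/a$. There is a function $h_F:\mathbb R\to\mathbb R$ such that for all $a<0$, $b\in\mathbb R$ and every invariant graph $\Gamma$ of $F_{a,b}$, the topological entropy of $F_{a,b}|_\Gamma$ equals $h_F(c)$; for $c>4$ such an invariant graph exists (so $h_F(c)$ is uniquely determined there). The entropy function $h_F$ is continuous at $c=8$. -/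

import Mathlib

open Filter Topology Set

/-- The piecewise linear map `F(x,y) = (|x| - y + a, x - |y| + b)` of the plane. -/
def planeMap (a b : ℝ) (p : ℝ × ℝ) : ℝ × ℝ :=
  (|p.1| - p.2 + a, p.1 - |p.2| + b)

/-- A compact graph with straight edges in the plane: a finite union of closed segments
(a degenerate segment is a point, so isolated vertices are allowed). -/
def IsCompactGraph (Γ : Set (ℝ × ℝ)) : Prop :=
  ∃ S : Finset ((ℝ × ℝ) × (ℝ × ℝ)), Γ = ⋃ s ∈ S, segment ℝ s.1 s.2

/-- `Γ` is an invariant graph capturing the dynamics of `planeMap a b`: it is a nonempty compact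
graph, the map sends it into itself, and every orbit of the plane enters `Γ`, or a finite
exceptional set of periodic points. (A repelling fixed point may lie off the
one-dimensional part of the graph; with `E = ∅` every orbit has to enter `Γ` itself.) -/
structure IsInvariantGraph (a b : ℝ) (Γ : Set (ℝ × ℝ)) : Prop where
  graph : IsCompactGraph Γ
  nonempty : Γ.Nonempty
  invariant : MapsTo (planeMap a b) Γ Γ
  absorbing : ∃ E : Set (ℝ × ℝ), E.Finite ∧ E ⊆ Function.periodicPts (planeMap a b) ∧
    ∀ x : ℝ × ℝ, ∃ n : ℕ, (planeMap a b)^[n] x ∈ Γ ∪ E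

/-!
The entropy on an invariant graph does not depend on the graph, because every orbit of one graph
ends up in any other one or in a finite set of periodic orbits, and what an orbit does before that
contributes no entropy. By homogeneity it is enough to consider `a = -1`.

Points of an edge with the same itinerary through the quadrants stay on a common segment, along
which all iterates are monotone, so the entropy is at most the growth rate of the number of
itineraries. On the explicit invariant graph, orbits follow a saddle of period three on the line
`y = x + c + 1`. The orbits on its left end in a cycle of period three. Those on its right leave and
come back to the line, but no further to the right of the saddle than `2 (8 - c) / 3`. Hence near
`c = 8` they need a long time to leave again, their itineraries fail to be periodic of period three
only with a small frequency, and the entropy is small.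
-/

/-! ### Frequency of visits -/

section Visits

variable {X : Type*} {T : X → X} {A : Set X} {x : X}

/-- The number of times `k < n` at which the orbit of `x` lies in `A`: the Birkhoff sum of the
indicator of `A`. -/
noncomputable def visits (T : X → X) (A : Set X) (x : X) (n : ℕ) : ℕ :=
  birkhoffSum T (A.indicator 1) n x

lemma visits_le (T : X → X) (A : Set X) (x : X) (n : ℕ) : visits T A x n ≤ n := by
  have hle : ∀ y, A.indicator (1 : X → ℕ) y ≤ 1 := fun y => indicator_le_self A 1 y
  simpa [visits, birkhoffSum] using Finset.sum_le_card_nsmul (Finset.range n) _ 1 fun _ _ => hle _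

lemma visits_add (T : X → X) (A : Set X) (x : X) (m n : ℕ) :
    visits T A x (m + n) = visits T A x m + visits T A (T^[m] x) n :=
  birkhoffSum_add ..

lemma visits_mono (T : X → X) (A : Set X) (x : X) : Monotone (visits T A x) :=
  monotone_nat_of_le_succ fun n => visits_add T A x n 1 ▸ Nat.le_add_right _ _

lemma visits_eq_zero_iff {n : ℕ} : visits T A x n = 0 ↔ ∀ k < n, T^[k] x ∉ A := by
  simp [visits, birkhoffSum]

lemma visits_le_visits {y : X} {n : ℕ} (h : ∀ k < n, T^[k] x ∈ A → T^[k] y ∈ A) :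
    visits T A x n ≤ visits T A y n := by
  classical
  unfold visits birkhoffSum
  refine Finset.sum_le_sum fun k hk => ?_
  by_cases hx : T^[k] x ∈ A
  · simp [hx, h k (Finset.mem_range.1 hk) hx]
  · simp [hx]

lemma visits_le_visits_add (T : X → X) (A : Set X) (x : X) (m n : ℕ) :
    visits T A x n ≤ visits T A x m + visits T A (T^[m] x) n := by
  rw [← visits_add]
  exact visits_mono T A x (Nat.le_add_left n m)

lemma visits_one_of_mem (hx : x ∈ A) : visits T A x 1 = 1 := by
  simp [visits, hx]

lemma visits_compl_le_of_forall_mem {n₀ : ℕ} (hx : ∀ k ≥ n₀, T^[k] x ∈ A) (n : ℕ) :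
    visits T Aᶜ x n ≤ n₀ := by
  have hzero : visits T Aᶜ (T^[n₀] x) n = 0 := visits_eq_zero_iff.2 fun k _ => by
    rw [← Function.iterate_add_apply]
    exact not_not.2 (hx _ (Nat.le_add_left _ _))
  calc visits T Aᶜ x n ≤ visits T Aᶜ x n₀ + visits T Aᶜ (T^[n₀] x) n := visits_le_visits_add ..
    _ ≤ n₀ := by simpa only [hzero, add_zero] using visits_le T Aᶜ x n₀

variable [TopologicalSpace X] {K N : Set X} {δ : ℝ}

lemma eventually_visits_compl_le (hT : Continuous T) (hN : IsOpen N) (x : X) (n : ℕ) :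
    ∀ᶠ y in 𝓝 x, visits T Nᶜ y n ≤ visits T Nᶜ x n := by
  have hstay : ∀ᶠ y in 𝓝 x, ∀ k ∈ Finset.range n, T^[k] x ∈ N → T^[k] y ∈ N :=
    (Filter.eventually_all_finset _).2 fun k _ => eventually_imp_distrib_left.2 fun hk =>
      (hT.iterate k).continuousAt.eventually_mem (hN.mem_nhds hk)
  filter_upwards [hstay] with y hy
  exact visits_le_visits fun k hk hyk hxk => hyk (hy k (Finset.mem_range.2 hk) hxk)

lemma exists_eventually_visits_compl_le_mul (hT : Continuous T) (hN : IsOpen N)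
    (hx : ∃ n, ∀ k ≥ n, T^[k] x ∈ N) (hδ : 0 < δ) :
    ∃ n > 0, ∀ᶠ y in 𝓝 x, (visits T Nᶜ y n : ℝ) ≤ δ * n := by
  obtain ⟨n₀, hn₀⟩ := hx
  obtain ⟨n, hn⟩ := exists_nat_gt ((n₀ : ℝ) / δ)
  have hn_pos : (0 : ℝ) < n := lt_of_le_of_lt (by positivity) hn
  refine ⟨n, by exact_mod_cast hn_pos, ?_⟩
  filter_upwards [eventually_visits_compl_le hT hN x n] with y hy
  calc (visits T Nᶜ y n : ℝ) ≤ n₀ := by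
        exact_mod_cast hy.trans (visits_compl_le_of_forall_mem hn₀ n)
    _ ≤ δ * n := ((div_lt_iff₀' hδ).1 hn).le

/-- By compactness finitely many return times suffice, and long orbits are cut along them. -/
lemma exists_visits_compl_le_mul_add (hT : Continuous T) (hK : IsCompact K) (hKK : MapsTo T K K)
    (hN : IsOpen N) (hKN : ∀ x ∈ K, ∃ n, ∀ k ≥ n, T^[k] x ∈ N) (hδ : 0 < δ) :
    ∃ D : ℕ, ∀ x ∈ K, ∀ n, (visits T Nᶜ x n : ℝ) ≤ δ * n + D := by
  choose! ν hν_pos hν using fun x hx =>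
    exists_eventually_visits_compl_le_mul hT hN (hKN x hx) hδ
  obtain ⟨t, htK, ht⟩ := hK.elim_nhds_subcover
    (fun x => {y | (visits T Nᶜ y (ν x) : ℝ) ≤ δ * ν x}) hν
  refine ⟨∑ z ∈ t, ν z, fun x hx n => ?_⟩
  induction n using Nat.strong_induction_on generalizing x with
  | _ n ih =>
    obtain ⟨z, hz, hxz⟩ := mem_iUnion₂.1 (ht hx)
    have hzD : ν z ≤ ∑ z ∈ t, ν z := Finset.single_le_sum (fun _ _ => Nat.zero_le _) hz
    rcases le_or_gt n (ν z) with hn | hn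
    · have hcard : (visits T Nᶜ x n : ℝ) ≤ (∑ z ∈ t, ν z : ℕ) := by
        exact_mod_cast (visits_le T Nᶜ x n).trans (hn.trans hzD)
      have : 0 ≤ δ * n := by positivity
      linarith
    · obtain ⟨k, rfl⟩ := Nat.exists_eq_add_of_le hn.le
      have hrest := ih k (by have := hν_pos z (htK z hz); omega) _ (hKK.iterate (ν z) hx)
      rw [visits_add]
      simp only [mem_ofPred_eq] at hxz
      push_cast at hrest ⊢
      linarith

end Visits

section Returns

variable {X : Type*} {T : X → X} {A R : Set X} {x : X} {δ : ℝ} {B : ℕ}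

lemma visits_le_of_forall_exists_return (hδ : 0 ≤ δ)
    (hR : ∀ x ∈ R, (∀ n, visits T A x n ≤ B) ∨
      ∃ m > 0, T^[m] x ∈ R ∧ visits T A x m ≤ B ∧ (visits T A x m : ℝ) ≤ δ * m)
    (hx : x ∈ R) (n : ℕ) : (visits T A x n : ℝ) ≤ δ * n + B := by
  induction n using Nat.strong_induction_on generalizing x with
  | _ n ih =>
    have hbounded (h : visits T A x n ≤ B) : (visits T A x n : ℝ) ≤ δ * n + B :=
      (Nat.cast_le.2 h).trans (le_add_of_nonneg_left (by positivity))
    rcases hR x hx with h | ⟨m, hm, hmem, hB, hle⟩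
    · exact hbounded (h n)
    rcases le_total n m with hnm | hmn
    · exact hbounded ((visits_mono T A x hnm).trans hB)
    · obtain ⟨k, rfl⟩ := Nat.exists_eq_add_of_le hmn
      have := ih k (by lia) hmem
      rw [visits_add]
      push_cast
      linarith

lemma visits_le_of_forall_exists_free_return
    (hR : ∀ x ∈ R, (∀ n, visits T A x n ≤ B) ∨ ∃ m > 0, T^[m] x ∈ R ∧ visits T A x m = 0)
    (hx : x ∈ R) (n : ℕ) : visits T A x n ≤ B := by
  have hreturn := visits_le_of_forall_exists_return (δ := 0) le_rfl (fun x hx =>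
    (hR x hx).imp_right fun ⟨m, hm, hmem, hzero⟩ => ⟨m, hm, hmem, by simp [hzero]⟩) hx n
  rw [zero_mul, zero_add] at hreturn
  exact_mod_cast hreturn

end Returns

/-! ### Labellings and entropy -/

section Labelling

open Dynamics

variable {X : Type*} {T : X → X} {S S' : Set X} {U : SetRel X X} {m n : ℕ} {κ κ' : ℝ}

/-- The points of `S` can be given at most `κ` labels in such a way that points with the same label
have `U`-close orbits up to time `n`. Unlike those of dynamical covers and nets, the bounds for such
labellings multiply when orbits are concatenated; `κ` is real so that estimates can be inserted. -/
def HasLabelling (T : X → X) (S : Set X) (U : SetRel X X) (n : ℕ) (κ : ℝ) : Prop :=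
  ∃ k : ℕ, (k : ℝ) ≤ κ ∧ ∃ l : S → Fin k, ∀ x y : S, l x = l y → (x.1, y.1) ∈ dynEntourage T U n

lemma HasLabelling.of_finite {ι : Type*} [Finite ι] (l : S → ι)
    (hl : ∀ x y : S, l x = l y → (x.1, y.1) ∈ dynEntourage T U n) (hκ : (Nat.card ι : ℝ) ≤ κ) :
    HasLabelling T S U n κ :=
  ⟨Nat.card ι, hκ, Finite.equivFin ι ∘ l, fun x y h => hl x y ((Finite.equivFin ι).injective h)⟩

lemma HasLabelling.nonneg (h : HasLabelling T S U n κ) : 0 ≤ κ :=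
  let ⟨k, hk, _⟩ := h
  k.cast_nonneg.trans hk

lemma HasLabelling.mono (h : HasLabelling T S U n κ) (hS : S' ⊆ S) (hn : m ≤ n) (hκ : κ ≤ κ') :
    HasLabelling T S' U m κ' := by
  obtain ⟨k, hk, l, hl⟩ := h
  exact ⟨k, hk.trans hκ, l ∘ inclusion hS, fun x y hxy =>
    dynEntourage_mono subset_rfl hn (hl _ _ hxy)⟩

lemma HasLabelling.union (h : HasLabelling T S U n κ) (h' : HasLabelling T S' U n κ') :
    HasLabelling T (S ∪ S') U n (κ + κ') := by
  classical
  obtain ⟨k, hk, l, hl⟩ := h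
  obtain ⟨k', hk', l', hl'⟩ := h'
  refine .of_finite (ι := Fin k ⊕ Fin k')
    (fun x => if hx : x.1 ∈ S then .inl (l ⟨x, hx⟩) else .inr (l' ⟨x, x.2.resolve_left hx⟩)) ?_ ?_
  · intro x y hxy
    by_cases hx : x.1 ∈ S <;> by_cases hy : y.1 ∈ S <;>
      simp only [hx, hy, dite_true, dite_false, Sum.inl.injEq, Sum.inr.injEq, reduceCtorEq] at hxy
    exacts [hl _ _ hxy, hl' _ _ hxy]
  · simpa using add_le_add hk hk'

lemma mem_dynEntourage_add {x y : X} (h : (x, y) ∈ dynEntourage T U m)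
    (h' : (T^[m] x, T^[m] y) ∈ dynEntourage T U n) : (x, y) ∈ dynEntourage T U (m + n) := by
  simp only [mem_dynEntourage] at h h' ⊢
  intro j hj
  rcases lt_or_ge j m with hjm | hjm
  · exact h j hjm
  · obtain ⟨i, rfl⟩ := Nat.exists_eq_add_of_le' hjm
    simpa only [Function.iterate_add_apply] using h' i (by omega)

lemma HasLabelling.concat (h : HasLabelling T S U m κ) (h' : HasLabelling T (T^[m] '' S) U n κ') :
    HasLabelling T S U (m + n) (κ * κ') := by
  have hκ := h.nonneg
  obtain ⟨k, hk, l, hl⟩ := h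
  obtain ⟨k', hk', l', hl'⟩ := h'
  refine .of_finite (ι := Fin k × Fin k')
    (fun x => (l x, l' ⟨T^[m] x, mem_image_of_mem _ x.2⟩)) (fun x y hxy => ?_) ?_
  · rw [Prod.mk.injEq] at hxy
    exact mem_dynEntourage_add (hl _ _ hxy.1) (hl' _ _ hxy.2)
  · simpa using mul_le_mul hk hk' k'.cast_nonneg hκ

lemma HasLabelling.of_isDynCoverOf {V : SetRel X X} [V.IsSymm] (hVU : V.comp V ⊆ U) {s : Finset X}
    (hs : IsDynCoverOf T S V n s) : HasLabelling T S U n s.card := by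
  choose l hls hl using fun x : S => hs x.2
  refine .of_finite (fun x : S => (⟨l x, hls x⟩ : s)) (fun x y hxy => ?_) (by simp)
  have hxy : l x = l y := congrArg Subtype.val hxy
  exact dynEntourage_mono hVU le_rfl
    (dynEntourage_comp_subset T V V n ⟨l x, hl x, hxy ▸ SetRel.symm _ (hl y)⟩)

lemma HasLabelling.coverMincard_le (h : HasLabelling T S U n κ) :
    ((coverMincard T S U n : ℕ∞) : ENNReal) ≤ ENNReal.ofReal κ := by
  classical
  obtain ⟨k, hk, l, hl⟩ := h
  rcases isEmpty_or_nonempty S with hS | hS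
  · simp [isEmpty_coe_sort.1 hS]
  let s : Finset X := Finset.univ.image fun i => ((Function.invFun l i : S) : X)
  have hs : IsDynCoverOf T S U n s := fun x hx =>
    ⟨(Function.invFun l (l ⟨x, hx⟩) : S), by simp [s],
      hl ⟨x, hx⟩ _ Function.apply_invFun_apply.symm⟩
  have hcard : s.card ≤ k := Finset.card_image_le.trans (by simp)
  calc ((coverMincard T S U n : ℕ∞) : ENNReal) ≤ ((k : ℕ∞) : ENNReal) := by
        gcongr
        exact hs.coverMincard_le_card.trans (by exact_mod_cast hcard)
    _ = ENNReal.ofReal (k : ℝ) := by simp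
    _ ≤ ENNReal.ofReal κ := ENNReal.ofReal_le_ofReal hk

variable [UniformSpace X] {A K N : Set X} {a b b' : ℝ}

lemma exp_coe_mul_natCast (b : ℝ) (n : ℕ) :
    EReal.exp ((b : EReal) * n) = ENNReal.ofReal (Real.exp (b * n)) := by
  rw [← EReal.exp_coe]
  push_cast
  rfl

lemma coverEntropy_le_of_hasLabelling
    (h : ∀ U ∈ uniformity X, ∀ b > a, ∃ D, ∀ n : ℕ, HasLabelling T K U n (D * Real.exp (b * n))) :
    coverEntropy T K ≤ (a : EReal) := by
  refine iSup₂_le fun U hU => EReal.le_of_forall_lt_iff_le.1 fun b hb => ?_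
  obtain ⟨D, hD⟩ := h U hU b (by exact_mod_cast hb)
  have hD₀ : 0 ≤ D := by simpa using (hD 0).nonneg
  have hbound (n : ℕ) : ((coverMincard T K U n : ℕ∞) : ENNReal) ≤
      ENNReal.ofReal D * EReal.exp ((b : EReal) * n) := by
    rw [exp_coe_mul_natCast, ← ENNReal.ofReal_mul hD₀]
    exact (hD n).coverMincard_le
  exact (ExpGrowth.expGrowthSup_le_of_eventually_le ENNReal.ofReal_ne_top
    (.of_forall hbound)).trans_eq ExpGrowth.expGrowthSup_exp

lemma coverEntropy_le_zero_of_finite (hA : A.Finite) (T : X → X) : coverEntropy T A ≤ 0 := by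
  have := hA.to_subtype
  refine coverEntropy_le_of_hasLabelling (a := 0) fun U hU b hb => ⟨Nat.card A, fun n => ?_⟩
  refine .of_finite id (fun x y hxy => ?_) (le_mul_of_one_le_right (Nat.cast_nonneg _) ?_)
  · rw [show x = y from hxy]
    exact mem_dynEntourage.2 fun _ _ => refl_mem_uniformity hU
  · exact Real.one_le_exp (by positivity)

lemma exists_finset_isDynCoverOf_card_le (h : coverEntropy T A ≤ (a : EReal)) (hab : a < b)
    (hU : U ∈ uniformity X) :
    ∀ᶠ n : ℕ in atTop, ∃ s : Finset X, IsDynCoverOf T A U n s ∧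
      (s.card : ℝ) ≤ Real.exp (b * n) := by
  have hlt : coverEntropyEntourage T A U < (b : EReal) :=
    ((coverEntropyEntourage_le_coverEntropy T A hU).trans h).trans_lt (by exact_mod_cast hab)
  filter_upwards [ExpGrowth.eventually_le_exp hlt] with n hn
  rw [exp_coe_mul_natCast] at hn
  have hfin : coverMincard T A U n < ⊤ :=
    ENat.toENNReal_lt_top.1 (hn.trans_lt ENNReal.ofReal_lt_top)
  obtain ⟨s, hs, hcard⟩ := (coverMincard_finite_iff _ _ _ _).1 hfin
  refine ⟨s, hs, (ENNReal.ofReal_le_ofReal_iff (Real.exp_pos _).le).1 ?_⟩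
  simpa [← hcard] using hn

lemma exists_isOpen_hasLabelling (hT : Continuous T) (h : coverEntropy T A ≤ (a : EReal))
    (hab : a < b) (hU : U ∈ uniformity X) :
    ∀ᶠ m : ℕ in atTop, ∃ N, IsOpen N ∧ A ⊆ N ∧ HasLabelling T N U m (Real.exp (b * m)) := by
  obtain ⟨V, hV, hV_open, hV_symm, hVU⟩ := comp_open_symm_mem_uniformity_sets hU
  filter_upwards [exists_finset_isDynCoverOf_card_le h hab hV] with m ⟨s, hs, hcard⟩
  let ball (y : X) : Set X := {x | (x, y) ∈ dynEntourage T V m}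
  have hball (y : X) : IsOpen (ball y) :=
    (isOpen.dynEntourage hT hV_open m).preimage (Continuous.prodMk_left y)
  refine ⟨⋃ y ∈ s, ball y, isOpen_biUnion fun y _ => hball y, fun x hx => ?_, ?_⟩
  · simpa [ball] using hs hx
  · have hcover : IsDynCoverOf T (⋃ y ∈ s, ball y) V m s := fun x hx => by simpa [ball] using hx
    exact (HasLabelling.of_isDynCoverOf hVU hcover).mono subset_rfl le_rfl hcard

end Labelling

section Counting

open Dynamics

variable {X : Type*} {T : X → X} {S K N : Set X} {U : SetRel X X} {m n : ℕ} {M C ρ B κ a b : ℝ}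

lemma HasLabelling.concat_half (h : HasLabelling T S U m M) (hMρ : 2 * M ≤ ρ)
    (h' : HasLabelling T (T^[m] '' S) U n κ) : HasLabelling T S U (m + n) (ρ * κ / 2) :=
  (h.concat h').mono subset_rfl le_rfl (by nlinarith [h'.nonneg])

lemma hasLabelling_empty (T : X → X) (U : SetRel X X) (n : ℕ) : HasLabelling T ∅ U n 0 :=
  .of_finite (ι := Empty) (fun x => x.2.elim) (fun x => x.2.elim) (by simp)

lemma hasLabelling_zero (T : X → X) (S : Set X) (U : SetRel X X) : HasLabelling T S U 0 1 :=
  .of_finite (fun _ => ()) (by simp) (by simp)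

/-- Splitting according to whether `x ∈ N`, an orbit is cut at time `m` or at time `1`. The factor
`ρ` per unit of time, and the additional factor `B` per visit outside `N`, are large enough that the
two halves fit together. -/
lemma hasLabelling_of_visits_le (hKK : MapsTo T K K) (hm : 0 < m) (hN : HasLabelling T N U m M)
    (hK : HasLabelling T K U 1 C) (hρ : 1 ≤ ρ) (hB : 1 ≤ B) (hM : 2 * M ≤ ρ ^ m)
    (hC : 2 * C ≤ ρ * B) (r : ℕ) (S : Set X)
    (hSK : S ⊆ K) (hS : ∀ x ∈ S, visits T Nᶜ x n ≤ r) :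
    HasLabelling T S U n ((2 * M + 1) * (ρ ^ n * B ^ r)) := by
  induction n using Nat.strong_induction_on generalizing r S with
  | _ n ih =>
  have hM₀ := hN.nonneg
  have hlarge : 1 ≤ ρ ^ n * B ^ r :=
    one_le_mul_of_one_le_of_one_le (one_le_pow₀ hρ) (one_le_pow₀ hB)
  rcases n.eq_zero_or_pos with rfl | hn
  · exact (hasLabelling_zero T S U).mono subset_rfl le_rfl (by nlinarith)
  have himage (j : ℕ) {S' : Set X} (hS' : S' ⊆ S) : T^[j] '' S' ⊆ K :=
    image_subset_iff.2 fun x hx => hKK.iterate j (hSK (hS' hx))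
  have hinside : HasLabelling T (S ∩ N) U n ((2 * M + 1) * (ρ ^ n * B ^ r) / 2) := by
    rcases le_or_gt n m with hnm | hnm
    · exact hN.mono inter_subset_right hnm (by nlinarith)
    obtain ⟨j, rfl⟩ := Nat.exists_eq_add_of_le hnm.le
    have hvisits : ∀ x ∈ S ∩ N, visits T Nᶜ (T^[m] x) j ≤ r := fun x hx =>
      (Nat.le_add_left ..).trans (visits_add T Nᶜ x m j ▸ hS x hx.1)
    have hrest := ih j (by omega) r _ (himage m inter_subset_left) (forall_mem_image.2 hvisits)
    exact ((hN.mono inter_subset_right le_rfl le_rfl).concat_half hM hrest).mono subset_rfl le_rfl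
      (by rw [pow_add]; exact le_of_eq (by ring))
  have houtside : HasLabelling T (S \ N) U n ((2 * M + 1) * (ρ ^ n * B ^ r) / 2) := by
    obtain ⟨j, rfl⟩ := Nat.exists_eq_add_of_le hn
    have hvisits : ∀ x ∈ S \ N, 1 + visits T Nᶜ (T^[1] x) j ≤ r := fun x hx => by
      simpa only [visits_add, visits_one_of_mem (A := Nᶜ) hx.2] using hS x hx.1
    rcases (S \ N).eq_empty_or_nonempty with hempty | ⟨x₀, hx₀⟩
    · exact hempty ▸ (hasLabelling_empty ..).mono subset_rfl le_rfl (by positivity)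
    obtain ⟨i, rfl⟩ := Nat.exists_eq_add_of_le ((Nat.le_add_right ..).trans (hvisits x₀ hx₀))
    have hrest := ih j (by omega) i _ (himage 1 sdiff_subset) <| forall_mem_image.2 fun x hx =>
      Nat.le_of_add_le_add_left (hvisits x hx)
    exact ((hK.mono (sdiff_subset.trans hSK) le_rfl le_rfl).concat_half hC hrest).mono subset_rfl
      le_rfl (by rw [pow_add, pow_add]; exact le_of_eq (by ring))
  simpa only [inter_union_sdiff, add_halves] using hinside.union houtside

variable [UniformSpace X]

lemma exists_hasLabelling_one (hK : IsCompact K) (hKK : MapsTo T K K) (hU : U ∈ uniformity X) :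
    ∃ C, HasLabelling T K U 1 C := by
  obtain ⟨V, hV, hV_symm, hVU⟩ := comp_symm_mem_uniformity_sets hU
  obtain ⟨s, hs⟩ := exists_isDynCoverOf_of_isCompact_invariant hK hKK hV 1
  exact ⟨s.card, .of_isDynCoverOf hVU hs⟩

lemma exists_hasLabelling_mul_exp (hT : Continuous T) (hK : IsCompact K) (hKK : MapsTo T K K)
    (hU : U ∈ uniformity X) (hN : IsOpen N) (hKN : ∀ x ∈ K, ∃ n, ∀ k ≥ n, T^[k] x ∈ N)
    (hm : 0 < m) (hNl : HasLabelling T N U m M) (ha : 0 ≤ a) (hM : 2 * M ≤ Real.exp (a * m))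
    (hab : a < b) : ∃ D, ∀ n : ℕ, HasLabelling T K U n (D * Real.exp (b * n)) := by
  obtain ⟨C, hC⟩ := exists_hasLabelling_one hK hKK hU
  have hC₀ := hC.nonneg
  have hM₀ := hNl.nonneg
  set B : ℝ := 2 * C + 1
  have hB₁ : 1 ≤ B := by linarith
  have hlogB : 0 ≤ Real.log B := Real.log_nonneg hB₁
  set δ : ℝ := (b - a) / (Real.log B + 1)
  have hδ₀ : 0 < δ := div_pos (sub_pos.2 hab) (by positivity)
  have hδB : δ * Real.log B ≤ b - a := by
    have : δ * (Real.log B + 1) = b - a := div_mul_cancel₀ _ (by positivity)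
    linarith
  obtain ⟨D, hD⟩ := exists_visits_compl_le_mul_add hT hK hKK hN hKN hδ₀
  refine ⟨(2 * M + 1) * Real.exp (D * Real.log B), fun n => ?_⟩
  set r := ⌊δ * n + D⌋₊
  have hr : (r : ℝ) ≤ δ * n + D := Nat.floor_le (by positivity)
  have hpow : Real.exp a ^ n * B ^ r ≤ Real.exp (D * Real.log B) * Real.exp (b * n) := calc
    Real.exp a ^ n * B ^ r = Real.exp (n * a + r * Real.log B) := by
      rw [Real.exp_add, Real.exp_nat_mul, Real.exp_nat_mul, Real.exp_log (by linarith)]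
    _ ≤ Real.exp (D * Real.log B + b * n) := Real.exp_le_exp.2 <| by
      nlinarith [mul_le_mul_of_nonneg_right hr hlogB,
        mul_le_mul_of_nonneg_right hδB (Nat.cast_nonneg (α := ℝ) n)]
    _ = _ := Real.exp_add ..
  refine (hasLabelling_of_visits_le hKK hm hNl hC (Real.one_le_exp ha) hB₁ ?_ ?_ r K subset_rfl
    fun x hx => Nat.le_floor (hD x hx n)).mono subset_rfl le_rfl ?_
  · rwa [← Real.exp_nat_mul, mul_comm (m : ℝ)]
  · nlinarith [Real.one_le_exp ha]
  · rw [mul_assoc (2 * M + 1)]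
    gcongr

/-- Only the part of a long orbit spent in a neighbourhood of `A` contributes exponentially many
labels, since by compactness the remaining part has density zero. -/
theorem coverEntropy_le_of_forall_exists_iterate_mem {A : Set X} (hT : Continuous T)
    (hK : IsCompact K) (hKK : MapsTo T K K) (hAA : MapsTo T A A)
    (hKA : ∀ x ∈ K, ∃ n, T^[n] x ∈ A) : coverEntropy T K ≤ coverEntropy T A := by
  rcases K.eq_empty_or_nonempty with rfl | ⟨x₀, hx₀⟩
  · simp
  obtain ⟨n₀, hn₀⟩ := hKA x₀ hx₀
  have hA : 0 ≤ coverEntropy T A := coverEntropy_nonneg T ⟨_, hn₀⟩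
  refine EReal.le_of_forall_lt_iff_le.1 fun a ha => coverEntropy_le_of_hasLabelling ?_
  intro U hU b hab
  have ha₀ : 0 ≤ a := by exact_mod_cast hA.trans ha.le
  obtain ⟨a₁, ha₁, hab₁⟩ := exists_between hab
  obtain ⟨a₂, ha₂, ha₂₁⟩ := exists_between ha₁
  have hlarge : ∀ᶠ m : ℕ in atTop, Real.log 2 ≤ (a₁ - a₂) * m :=
    (tendsto_natCast_atTop_atTop.const_mul_atTop (sub_pos.2 ha₂₁)).eventually_ge_atTop _
  obtain ⟨m, ⟨N, hN, hAN, hNl⟩, hm, hm₂⟩ := ((exists_isOpen_hasLabelling hT ha.le ha₂ hU).and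
    ((eventually_gt_atTop 0).and hlarge)).exists
  refine exists_hasLabelling_mul_exp hT hK hKK hU hN (fun x hx => ?_) hm hNl
    (ha₀.trans ha₁.le) ?_ hab₁
  · obtain ⟨n, hn⟩ := hKA x hx
    refine ⟨n, fun k hk => hAN ?_⟩
    obtain ⟨j, rfl⟩ := Nat.exists_eq_add_of_le' hk
    rw [Function.iterate_add_apply]
    exact hAA.iterate j hn
  · calc 2 * Real.exp (a₂ * m) ≤ Real.exp ((a₁ - a₂) * m) * Real.exp (a₂ * m) := by
          gcongr
          exact (Real.log_le_iff_le_exp two_pos).1 hm₂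
      _ = Real.exp (a₁ * m) := by rw [← Real.exp_add]; ring_nf

end Counting

/-! ### Itineraries of piecewise affine maps -/

section Itinerary

variable {ι E : Type*} [AddCommGroup E] [Module ℝ E] {T : E → E} {q : E → ι}
  {L : ι → Module.End ℝ E}

/-- `T` is affine with linear part `L i` on each piece `{x | q x = i}` of a partition of `E`. -/
def IsPiecewiseAffine (T : E → E) (q : E → ι) (L : ι → Module.End ℝ E) : Prop :=
  ∀ x y, q x = q y → T x - T y = L (q x) (x - y)

/-- The sequence of pieces of the partition `q` visited by the orbit of `x`. -/
def itinerary {X : Type*} (T : X → X) (q : X → ι) (x : X) (k : ℕ) : ι := q (T^[k] x)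

/-- The words of length `n` that occur as initial segments of itineraries of points of `S`. -/
def itineraryWords {X : Type*} (T : X → X) (q : X → ι) (S : Set X) (n : ℕ) : Set (Fin n → ι) :=
  (fun x k => itinerary T q x k) '' S

/-- The linear part of the `n`-th iterate of a piecewise affine map at a point with
itinerary `w`. -/
def iterateLinearPart (L : ι → Module.End ℝ E) (w : ℕ → ι) : ℕ → Module.End ℝ E
  | 0 => 1
  | n + 1 => L (w n) * iterateLinearPart L w n

lemma iterateLinearPart_congr {w w' : ℕ → ι} {n : ℕ} (h : ∀ k < n, w k = w' k) :
    iterateLinearPart L w n = iterateLinearPart L w' n := by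
  induction n with
  | zero => rfl
  | succ n ih =>
    rw [iterateLinearPart, iterateLinearPart, h n n.lt_succ_self,
      ih fun k hk => h k (hk.trans n.lt_succ_self)]

lemma IsPiecewiseAffine.iterate_sub_iterate (hT : IsPiecewiseAffine T q L) {x y : E} {n : ℕ}
    (h : ∀ k < n, itinerary T q x k = itinerary T q y k) :
    T^[n] x - T^[n] y = iterateLinearPart L (itinerary T q x) n (x - y) := by
  induction n with
  | zero => rfl
  | succ n ih =>
    rw [Function.iterate_succ_apply', Function.iterate_succ_apply', hT _ _ (h n n.lt_succ_self),
      ih fun k hk => h k (hk.trans n.lt_succ_self)]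
    rfl

end Itinerary

section Floor

variable {ε R s : ℝ} {Q : ℕ}

/-- The index `⌊x / ε⌋` of the interval of length `ε` containing `x`, counted downwards if `d < 0`,
so that it increases along motions in the direction of `d`. -/
noncomputable def signedFloor (ε d x : ℝ) : ℤ := if 0 ≤ d then ⌊x / ε⌋ else -⌊x / ε⌋

lemma signedFloor_le_of_sub_eq {d x y : ℝ} (hε : 0 < ε) (hs : 0 ≤ s) (hxy : y - x = s * d) :
    signedFloor ε d x ≤ signedFloor ε d y := by
  unfold signedFloor
  split_ifs with hd
  · have : 0 ≤ s * d := mul_nonneg hs hd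
    gcongr
    linarith
  · have : s * d ≤ 0 := mul_nonpos_of_nonneg_of_nonpos hs (not_le.1 hd).le
    gcongr
    linarith

lemma abs_sub_lt_of_signedFloor_eq {d x y : ℝ} (hε : 0 < ε)
    (h : signedFloor ε d x = signedFloor ε d y) : |x - y| < ε := by
  have hfloor : ⌊x / ε⌋ = ⌊y / ε⌋ := by
    unfold signedFloor at h
    split_ifs at h
    exacts [h, neg_injective h]
  have := Int.abs_sub_lt_one_of_floor_eq_floor hfloor
  rwa [← sub_div, abs_div, abs_of_pos hε, div_lt_one hε] at this

lemma abs_signedFloor_le {d x : ℝ} (hε : 0 < ε) (hx : |x| ≤ R) (hQ : R / ε + 1 ≤ Q) :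
    |signedFloor ε d x| ≤ Q := by
  have hfloor : |signedFloor ε d x| = |⌊x / ε⌋| := by
    unfold signedFloor
    split_ifs <;> simp
  have hdiv : |x / ε| ≤ R / ε := by
    rw [abs_div, abs_of_pos hε]
    gcongr
  obtain ⟨hl, hu⟩ := abs_le.1 hdiv
  rw [hfloor, abs_le, Int.le_floor, Int.floor_le_iff]
  push_cast
  constructor <;> linarith

/-- The sum of the signed floors of the coordinates, an integer that increases along motions in the
direction of `d`. -/
noncomputable def directedFloor (ε : ℝ) (d x : ℝ × ℝ) : ℤ :=
  signedFloor ε d.1 x.1 + signedFloor ε d.2 x.2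

lemma directedFloor_le_of_sub_eq {d x y : ℝ × ℝ} (hε : 0 < ε) (hs : 0 ≤ s)
    (hxy : y - x = s • d) : directedFloor ε d x ≤ directedFloor ε d y :=
  add_le_add (signedFloor_le_of_sub_eq hε hs (congrArg Prod.fst hxy))
    (signedFloor_le_of_sub_eq hε hs (congrArg Prod.snd hxy))

lemma dist_lt_of_directedFloor_eq {d x y : ℝ × ℝ} (hε : 0 < ε) (hs : 0 ≤ s) (hxy : y - x = s • d)
    (h : directedFloor ε d x = directedFloor ε d y) : dist x y < ε := by
  obtain ⟨h₁, h₂⟩ := (add_eq_add_iff_eq_and_eq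
    (signedFloor_le_of_sub_eq hε hs (congrArg Prod.fst hxy))
    (signedFloor_le_of_sub_eq hε hs (congrArg Prod.snd hxy))).1 h
  exact max_lt (abs_sub_lt_of_signedFloor_eq hε h₁) (abs_sub_lt_of_signedFloor_eq hε h₂)

lemma abs_directedFloor_le {d x : ℝ × ℝ} (hε : 0 < ε) (hx : ‖x‖ ≤ R) (hQ : R / ε + 1 ≤ Q) :
    |directedFloor ε d x| ≤ 2 * Q := by
  have h₁ := abs_signedFloor_le (d := d.1) hε ((norm_fst_le x).trans hx) hQ
  have h₂ := abs_signedFloor_le (d := d.2) hε ((norm_snd_le x).trans hx) hQ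
  exact (abs_add_le _ _).trans (by linarith)

end Floor

section Growth

variable {ι : Type*} {T : ℝ × ℝ → ℝ × ℝ} {q : ℝ × ℝ → ι} {L : ι → Module.End ℝ (ℝ × ℝ)}
  {x y v : ℝ × ℝ} {ε s R D h : ℝ} {n Q : ℕ} {Γ : Set (ℝ × ℝ)}

/-- The sum of the directed floors along the orbit of `x` up to time `n`, the direction being the
image of `v` under the linear parts of the iterates. Among points of a line with direction `v` and
with the same itinerary, it determines the orbit up to `ε`. -/
noncomputable def floorSum (T : ℝ × ℝ → ℝ × ℝ) (q : ℝ × ℝ → ι) (L : ι → Module.End ℝ (ℝ × ℝ))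
    (ε : ℝ) (n : ℕ) (v x : ℝ × ℝ) : ℤ :=
  ∑ k ∈ Finset.range n, directedFloor ε (iterateLinearPart L (itinerary T q x) k v) (T^[k] x)

/-- The summands of `floorSum` are monotone along the line, so that equal sums have equal terms. -/
lemma IsPiecewiseAffine.dist_iterate_lt_of_floorSum_eq (hT : IsPiecewiseAffine T q L) (hε : 0 < ε)
    (hs : 0 ≤ s) (hxy : y - x = s • v) (hq : ∀ k < n, itinerary T q x k = itinerary T q y k)
    (h : floorSum T q L ε n v x = floorSum T q L ε n v y) {j : ℕ} (hj : j < n) :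
    dist (T^[j] x) (T^[j] y) < ε := by
  have hq' (k : ℕ) (hk : k < n) (i : ℕ) (hi : i < k) : itinerary T q y i = itinerary T q x i :=
    (hq i (hi.trans hk)).symm
  have hsub (k : ℕ) (hk : k < n) :
      T^[k] y - T^[k] x = s • iterateLinearPart L (itinerary T q x) k v := by
    rw [hT.iterate_sub_iterate (hq' k hk), hxy, map_smul, iterateLinearPart_congr (hq' k hk)]
  have hfloorSum : floorSum T q L ε n v y = ∑ k ∈ Finset.range n,
      directedFloor ε (iterateLinearPart L (itinerary T q x) k v) (T^[k] y) :=
    Finset.sum_congr rfl fun k hk => by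
      rw [iterateLinearPart_congr (hq' k (Finset.mem_range.1 hk))]
  rw [hfloorSum, floorSum, Finset.sum_eq_sum_iff_of_le fun k hk =>
    directedFloor_le_of_sub_eq hε hs (hsub k (Finset.mem_range.1 hk))] at h
  exact dist_lt_of_directedFloor_eq hε hs (hsub j hj) (h j (Finset.mem_range.2 hj))

lemma abs_floorSum_le (hε : 0 < ε) (hQ : R / ε + 1 ≤ Q) (hx : ∀ k, ‖T^[k] x‖ ≤ R) :
    |floorSum T q L ε n v x| ≤ 2 * n * Q := calc
  |floorSum T q L ε n v x| ≤ ∑ k ∈ Finset.range n, (2 * Q : ℤ) :=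
    (Finset.abs_sum_le_sum_abs _ _).trans
      (Finset.sum_le_sum fun k _ => abs_directedFloor_le hε (hx k) hQ)
  _ = 2 * n * Q := by simp; ring

lemma exists_smul_sub_of_mem_segment {x y p v : ℝ × ℝ} (hx : x ∈ segment ℝ p v)
    (hy : y ∈ segment ℝ p v) : ∃ s : ℝ, y - x = s • (v - p) := by
  rw [segment_eq_image'] at hx hy
  obtain ⟨t, -, rfl⟩ := hx
  obtain ⟨u, -, rfl⟩ := hy
  exact ⟨u - t, by rw [add_sub_add_left_eq_sub, sub_smul]⟩

/-- A point is labelled by an edge containing it, its itinerary, and its `floorSum`, which takes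
linearly many values. -/
lemma IsPiecewiseAffine.hasLabelling [Finite ι] (hT : IsPiecewiseAffine T q L)
    {S : Finset ((ℝ × ℝ) × (ℝ × ℝ))} (hΓ : MapsTo T (⋃ s ∈ S, segment ℝ s.1 s.2)
      (⋃ s ∈ S, segment ℝ s.1 s.2)) (hR : ∀ x ∈ ⋃ s ∈ S, segment ℝ s.1 s.2, ‖x‖ ≤ R)
    (hε : 0 < ε) (hQ : R / ε + 1 ≤ Q) (n : ℕ) :
    HasLabelling T (⋃ s ∈ S, segment ℝ s.1 s.2) {p | dist p.1 p.2 < ε} n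
      (S.card * ((itineraryWords T q (⋃ s ∈ S, segment ℝ s.1 s.2) n).ncard *
        (4 * n * Q + 1 : ℕ))) := by
  set Γ : Set (ℝ × ℝ) := ⋃ s ∈ S, segment ℝ s.1 s.2
  choose e heS he using fun x : Γ => mem_iUnion₂.1 x.2
  let I := Finset.Icc (-(2 * n * Q) : ℤ) (2 * n * Q)
  have hI (x : Γ) : floorSum T q L ε n ((e x).2 - (e x).1) x ∈ I :=
    Finset.mem_Icc.2 (abs_le.1 (abs_floorSum_le hε hQ fun k => hR _ (hΓ.iterate k x.2)))
  let label (x : Γ) : S × itineraryWords T q Γ n × I :=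
    (⟨e x, heS x⟩, ⟨fun k => itinerary T q x k, x, x.2, rfl⟩, ⟨_, hI x⟩)
  refine .of_finite label (fun x y hxy => ?_) (le_of_eq ?_)
  · simp only [label, Prod.mk.injEq, Subtype.mk.injEq] at hxy
    obtain ⟨hedge, hword, hsum⟩ := hxy
    have hq (k : ℕ) (hk : k < n) : itinerary T q x k = itinerary T q y k :=
      congrFun (congrArg Subtype.val hword) ⟨k, hk⟩
    rw [← hedge] at hsum
    obtain ⟨s, hs⟩ := exists_smul_sub_of_mem_segment (he x) (hedge ▸ he y)
    refine Dynamics.mem_dynEntourage.2 fun j hj => ?_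
    rcases le_total 0 s with hs₀ | hs₀
    · exact hT.dist_iterate_lt_of_floorSum_eq hε hs₀ hs hq hsum hj
    · rw [mem_ofPred_eq, dist_comm]
      exact hT.dist_iterate_lt_of_floorSum_eq hε (neg_nonneg.2 hs₀)
        (by rw [neg_smul, ← hs, neg_sub]) (fun k hk => (hq k hk).symm) hsum.symm hj
  · have hcard : I.card = 4 * n * Q + 1 := by
      rw [Int.card_Icc]
      lia
    simp [hcard]

lemma IsCompactGraph.isCompact (hΓ : IsCompactGraph Γ) : IsCompact Γ := by
  obtain ⟨S, rfl⟩ := hΓ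
  refine S.isCompact_biUnion fun s _ => ?_
  rw [segment_eq_image]
  exact isCompact_Icc.image (by fun_prop)

lemma linear_le_mul_exp {c δ : ℝ} (hc : 0 ≤ c) (hδ : 0 < δ) (t : ℝ) (ht : 0 ≤ t) :
    c * t + 1 ≤ (c / δ + 1) * Real.exp (δ * t) := by
  have hexp := Real.add_one_le_exp (δ * t)
  calc c * t + 1 = c / δ * (δ * t) + 1 := by field_simp
    _ ≤ c / δ * Real.exp (δ * t) + Real.exp (δ * t) := by
      gcongr
      · linarith
      · exact Real.one_le_exp (by positivity)
    _ = _ := by ring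

theorem IsPiecewiseAffine.coverEntropy_le [Finite ι] (hT : IsPiecewiseAffine T q L)
    (hΓ : IsCompactGraph Γ) (hinv : MapsTo T Γ Γ)
    (hwords : ∀ n : ℕ, ((itineraryWords T q Γ n).ncard : ℝ) ≤ D * Real.exp (h * n)) :
    Dynamics.coverEntropy T Γ ≤ (h : EReal) := by
  obtain ⟨R, hR⟩ := hΓ.isCompact.isBounded.exists_norm_le
  obtain ⟨S, rfl⟩ := hΓ
  refine coverEntropy_le_of_hasLabelling fun U hU b hb => ?_
  obtain ⟨ε, hε, hεU⟩ := Metric.mem_uniformity_dist.1 hU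
  obtain ⟨Q, hQ⟩ := exists_nat_ge (R / ε + 1)
  refine ⟨S.card * (D * (4 * Q / (b - h) + 1)), fun n => ?_⟩
  obtain ⟨k, hk, l, hl⟩ := hT.hasLabelling hinv hR hε hQ n
  refine ⟨k, hk.trans ?_, l, fun x y hxy =>
    Dynamics.dynEntourage_mono (fun _ => @hεU _ _) le_rfl (hl x y hxy)⟩
  have hlin := linear_le_mul_exp (c := 4 * Q) (by positivity) (sub_pos.2 hb) n n.cast_nonneg
  push_cast
  calc (S.card : ℝ) * ((itineraryWords T q _ n).ncard * (4 * n * Q + 1))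
      ≤ S.card * (D * Real.exp (h * n) *
        ((4 * Q / (b - h) + 1) * Real.exp ((b - h) * n))) := by
        gcongr
        · exact (Nat.cast_nonneg _).trans (hwords n)
        · exact hwords n
        · linarith
    _ = S.card * (D * (4 * Q / (b - h) + 1)) * Real.exp (b * n) := by
        rw [show b * n = h * n + (b - h) * n by ring, Real.exp_add]
        ring

lemma IsPiecewiseAffine.coverEntropy_le_log_card [Finite ι] (hT : IsPiecewiseAffine T q L)
    (hΓ : IsCompactGraph Γ) (hinv : MapsTo T Γ Γ) :
    Dynamics.coverEntropy T Γ ≤ (Real.log (Nat.card ι) : EReal) := by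
  have : Nonempty ι := ⟨q 0⟩
  refine hT.coverEntropy_le hΓ hinv (D := 1) fun n => ?_
  rw [mul_comm (Real.log _), Real.exp_nat_mul, Real.exp_log (by exact_mod_cast Nat.card_pos),
    one_mul]
  exact_mod_cast (Set.ncard_le_card _).trans_eq (by rw [Nat.card_fun, Nat.card_fin])

end Growth

/-! ### Almost periodic itineraries -/

section Deviations

variable {ι X : Type*} {p n r : ℕ}

open Classical in
/-- The encoding of a word by its deviations from being `p`-periodic: the letters that repeat the
letter `p` places before are erased. -/
noncomputable def deviations (p : ℕ) (w : Fin n → ι) (i : Fin n) : Option ι :=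
  if p ≤ (i : ℕ) ∧ w i = w ⟨i - p, by lia⟩ then none else some (w i)

open Classical in
/-- The number of letters of a word that do not repeat the letter `p` places before. -/
noncomputable def deviationCount (p : ℕ) (w : Fin n → ι) : ℕ :=
  (Finset.univ.filter fun i => deviations p w i ≠ none).card

/-- The points whose piece of the partition `q` changes after `p` steps. -/
def deviationSet (T : X → X) (q : X → ι) (p : ℕ) : Set X := {x | q (T^[p] x) ≠ q x}

lemma visits_deviationSet_eq_zero_iff {T : X → X} {q : X → ι} {x : X} :
    visits T (deviationSet T q p) x n = 0 ↔
      (fun k : Fin n => itinerary T q (T^[p] x) k) = fun k : Fin n => itinerary T q x k := by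
  simp only [visits_eq_zero_iff, deviationSet, mem_ofPred_eq, not_not, funext_iff, Fin.forall_iff,
    itinerary, ← Function.iterate_add_apply, add_comm p]

lemma deviations_eq_none_iff {w : Fin n → ι} {i : Fin n} :
    deviations p w i = none ↔ p ≤ (i : ℕ) ∧ w i = w ⟨i - p, by lia⟩ := by
  simp [deviations]

lemma deviations_injective (hp : 0 < p) : Function.Injective (deviations (ι := ι) (n := n) p) := by
  intro w w' h
  suffices hk : ∀ (k : ℕ) (hk : k < n), w ⟨k, hk⟩ = w' ⟨k, hk⟩ from funext fun i => hk i i.2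
  intro k
  induction k using Nat.strong_induction_on with
  | _ k ih =>
    intro hk
    have hletter := congrFun h ⟨k, hk⟩
    unfold deviations at hletter
    split_ifs at hletter with hrep hrep'
    · rw [hrep.2, hrep'.2]
      exact ih (k - p) (by lia) _
    · exact Option.some_injective _ hletter

/-- A generating function bound: each deviation is given the weight `z`. -/
lemma ncard_deviationCount_le_mul_pow_le [Finite ι] {z : ℝ} (hp : 0 < p) (hz : 0 ≤ z)
    (hz₁ : z ≤ 1) (n r : ℕ) :
    ({w : Fin n → ι | deviationCount p w ≤ r}.ncard : ℝ) * z ^ r ≤ (1 + Nat.card ι * z) ^ n := by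
  classical
  have := Fintype.ofFinite ι
  let weight (f : Fin n → Option ι) : ℝ := ∏ i, (f i).elim 1 fun _ => z
  have hweight_nonneg (f : Fin n → Option ι) : 0 ≤ weight f := Finset.prod_nonneg fun i _ => by
    cases f i <;> simp [hz]
  have hweight (w : Fin n → ι) : weight (deviations p w) = z ^ deviationCount p w := by
    rw [deviationCount, ← Finset.prod_const, Finset.prod_filter]
    refine Finset.prod_congr rfl fun i _ => ?_
    cases deviations p w i <;> simp
  let W : Finset (Fin n → ι) := {w | deviationCount p w ≤ r}
  calc ({w : Fin n → ι | deviationCount p w ≤ r}.ncard : ℝ) * z ^ r = W.card * z ^ r := by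
        rw [← Set.ncard_coe_finset, Finset.coe_filter_univ]
    _ ≤ ∑ w ∈ W, weight (deviations p w) := by
        rw [← nsmul_eq_mul]
        refine Finset.card_nsmul_le_sum _ _ _ fun w hw => ?_
        rw [hweight]
        exact pow_le_pow_of_le_one hz hz₁ (Finset.mem_filter.1 hw).2
    _ = ∑ f ∈ W.image (deviations p), weight f :=
        (Finset.sum_image (deviations_injective hp).injOn).symm
    _ ≤ ∑ f, weight f :=
        Finset.sum_le_sum_of_subset_of_nonneg (Finset.subset_univ _) fun f _ _ => hweight_nonneg f
    _ = (1 + Nat.card ι * z) ^ n := by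
        rw [← Fintype.sum_pow (fun o : Option ι => o.elim 1 fun _ => z), Fintype.sum_option]
        simp

lemma deviationCount_itinerary_le (T : X → X) (q : X → ι) (p : ℕ) (x : X) (n : ℕ) :
    deviationCount p (fun i : Fin n => itinerary T q x i) ≤
      p + visits T (deviationSet T q p) x n := by
  classical
  have hvisits : visits T (deviationSet T q p) x n =
      ((Finset.range n).filter fun k => T^[k] x ∈ deviationSet T q p).card := by
    simp only [visits, birkhoffSum, indicator_apply, Pi.one_apply,
      Finset.card_filter _ (Finset.range n)]
  rw [deviationCount, hvisits, ← Finset.card_map Fin.valEmbedding]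
  suffices hsub : Finset.map Fin.valEmbedding _ ⊆ Finset.range p ∪
      ((Finset.range n).filter fun k => T^[k] x ∈ deviationSet T q p).map (addRightEmbedding p) by
    simpa only [Finset.card_range, Finset.card_map] using
      (Finset.card_le_card hsub).trans (Finset.card_union_le _ _)
  intro k hk
  obtain ⟨i, hi, rfl⟩ := Finset.mem_map.1 hk
  rw [Finset.mem_union, Finset.mem_range, Finset.mem_map]
  refine (lt_or_ge (i : ℕ) p).imp_right fun hip => ⟨i - p, ?_, Nat.sub_add_cancel hip⟩
  refine Finset.mem_filter.2 ⟨Finset.mem_range.2 (by lia), ?_⟩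
  rw [deviationSet, mem_ofPred_eq, ← Function.iterate_add_apply, Nat.add_sub_cancel' hip]
  exact fun hrep => (Finset.mem_filter.1 hi).2 (deviations_eq_none_iff.2 ⟨hip, hrep⟩)

end Deviations

section SmallEntropy

variable {ι : Type*} [Finite ι]

lemma ncard_itineraryWords_le {X : Type*} {T : X → X} {q : X → ι} {S : Set X} {p n : ℕ} {δ D z : ℝ}
    (hp : 0 < p) (hz : 0 < z) (hz₁ : z ≤ 1) (hn : 0 ≤ δ * n + D)
    (hS : ∀ x ∈ S, (visits T (deviationSet T q p) x n : ℝ) ≤ δ * n + D) :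
    ((itineraryWords T q S n).ncard : ℝ) ≤ Real.exp (-Real.log z * (p + D)) *
      Real.exp ((Real.log (1 + Nat.card ι * z) + δ * -Real.log z) * n) := by
  set r := ⌊p + (δ * n + D)⌋₊
  have hsub : itineraryWords T q S n ⊆ {w | deviationCount p w ≤ r} := by
    rintro _ ⟨x, hx, rfl⟩
    have hcount : (deviationCount p (fun i : Fin n => itinerary T q x i) : ℝ) ≤
        p + visits T (deviationSet T q p) x n := by
      exact_mod_cast deviationCount_itinerary_le T q p x n
    exact Nat.le_floor (hcount.trans (by gcongr; exact hS x hx))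
  have hpow : (z ^ r)⁻¹ ≤ Real.exp (-Real.log z * (p + (δ * n + D))) := by
    rw [← Real.rpow_natCast, Real.rpow_def_of_pos hz, ← Real.exp_neg, ← neg_mul]
    gcongr
    · exact neg_nonneg.2 (Real.log_nonpos hz.le hz₁)
    · exact Nat.floor_le (by positivity)
  calc ((itineraryWords T q S n).ncard : ℝ)
      ≤ ({w : Fin n → ι | deviationCount p w ≤ r}.ncard : ℝ) := by
        exact_mod_cast Set.ncard_le_ncard hsub
    _ ≤ (1 + Nat.card ι * z) ^ n * (z ^ r)⁻¹ := by
        rw [← div_eq_mul_inv, le_div_iff₀ (by positivity)]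
        exact ncard_deviationCount_le_mul_pow_le hp hz.le hz₁ n r
    _ ≤ Real.exp (Real.log (1 + Nat.card ι * z) * n) *
          Real.exp (-Real.log z * (p + (δ * n + D))) := by
        rw [mul_comm (Real.log (1 + _)), Real.exp_nat_mul, Real.exp_log (by positivity)]
        gcongr
    _ = _ := by
        rw [← Real.exp_add, ← Real.exp_add]
        ring_nf

theorem IsPiecewiseAffine.coverEntropy_le_of_visits_le {T : ℝ × ℝ → ℝ × ℝ} {q : ℝ × ℝ → ι}
    {L : ι → Module.End ℝ (ℝ × ℝ)} {Γ : Set (ℝ × ℝ)} {p : ℕ} {δ D z : ℝ}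
    (hT : IsPiecewiseAffine T q L) (hΓ : IsCompactGraph Γ) (hinv : MapsTo T Γ Γ) (hp : 0 < p)
    (hz : 0 < z) (hz₁ : z ≤ 1)
    (hvisits : ∀ x ∈ Γ, ∀ n, (visits T (deviationSet T q p) x n : ℝ) ≤ δ * n + D) :
    Dynamics.coverEntropy T Γ ≤
      ((Real.log (1 + Nat.card ι * z) + δ * -Real.log z : ℝ) : EReal) := by
  rcases Γ.eq_empty_or_nonempty with rfl | ⟨x, hx⟩
  · simp
  · exact hT.coverEntropy_le hΓ hinv fun n => ncard_itineraryWords_le hp hz hz₁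
      ((Nat.cast_nonneg _).trans (hvisits x hx n)) fun y hy => hvisits y hy n

theorem exists_forall_coverEntropy_le_of_visits_le (ι : Type*) [Finite ι] {ε : ℝ} (hε : 0 < ε) :
    ∃ δ > 0, ∀ {T : ℝ × ℝ → ℝ × ℝ} {q : ℝ × ℝ → ι} {L : ι → Module.End ℝ (ℝ × ℝ)}
      {Γ : Set (ℝ × ℝ)} {p : ℕ} {D : ℝ}, IsPiecewiseAffine T q L → IsCompactGraph Γ →
      MapsTo T Γ Γ → 0 < p →
      (∀ x ∈ Γ, ∀ n, (visits T (deviationSet T q p) x n : ℝ) ≤ δ * n + D) →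
      Dynamics.coverEntropy T Γ ≤ (ε : EReal) := by
  have hlim : ContinuousAt (fun z : ℝ => Real.log (1 + Nat.card ι * z)) 0 :=
    (by fun_prop : ContinuousAt (fun z : ℝ => 1 + Nat.card ι * z) 0).log (by simp)
  have hsmall : ∀ᶠ z in 𝓝[>] (0 : ℝ), Real.log (1 + Nat.card ι * z) < ε / 2 :=
    nhdsWithin_le_nhds (hlim.eventually_lt_const (by simpa using hε))
  obtain ⟨z, hzlog, hz, hz₁⟩ := (hsmall.and (Ioo_mem_nhdsGT one_pos)).exists
  have hlog : 0 ≤ -Real.log z := neg_nonneg.2 (Real.log_nonpos hz.le hz₁.le)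
  refine ⟨ε / 2 / (-Real.log z + 1), by positivity, fun hT hΓ hinv hp hvisits =>
    (hT.coverEntropy_le_of_visits_le hΓ hinv hp hz hz₁.le hvisits).trans
      (EReal.coe_le_coe_iff.2 ?_)⟩
  have : ε / 2 / (-Real.log z + 1) * -Real.log z ≤ ε / 2 := by
    rw [div_mul_eq_mul_div]
    exact div_le_of_le_mul₀ (by positivity) (by positivity) (by gcongr; linarith)
  linarith

end SmallEntropy

/-! ### The core graph -/

section Quadrants

/-- The partition of the plane into quadrants, on each of which `planeMap` is affine; a coordinate
is recorded by whether it is nonnegative. -/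
noncomputable def quadrant (p : ℝ × ℝ) : Bool × Bool := (decide (0 ≤ p.1), decide (0 ≤ p.2))

/-- The sign of a coordinate, as recorded by `quadrant`. -/
def boolSign (s : Bool) : ℝ := if s then 1 else -1

lemma abs_eq_boolSign_mul (x : ℝ) : |x| = boolSign (decide (0 ≤ x)) * x := by
  rcases le_or_gt 0 x with hx | hx
  · simp [boolSign, hx, abs_of_nonneg]
  · simp [boolSign, not_le.2 hx, abs_of_neg hx]

/-- The linear part of `planeMap` on a quadrant. -/
noncomputable def quadrantLinearPart (i : Bool × Bool) : Module.End ℝ (ℝ × ℝ) :=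
  (boolSign i.1 • LinearMap.fst ℝ ℝ ℝ - LinearMap.snd ℝ ℝ ℝ).prod
    (LinearMap.fst ℝ ℝ ℝ - boolSign i.2 • LinearMap.snd ℝ ℝ ℝ)

lemma planeMap_eq (a b : ℝ) (p : ℝ × ℝ) :
    planeMap a b p = quadrantLinearPart (quadrant p) p + (a, b) := by
  rw [planeMap, abs_eq_boolSign_mul p.1, abs_eq_boolSign_mul p.2]
  rfl

lemma isPiecewiseAffine_planeMap (a b : ℝ) :
    IsPiecewiseAffine (planeMap a b) quadrant quadrantLinearPart := fun p p' h => by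
  rw [planeMap_eq, planeMap_eq, h, add_sub_add_right_eq_sub, map_sub]

end Quadrants

section CoreGraph

lemma planeMap_quadrant_one {a b x y : ℝ} (hx : 0 ≤ x) (hy : 0 ≤ y) :
    planeMap a b (x, y) = (x - y + a, x - y + b) := by
  rw [planeMap, abs_of_nonneg hx, abs_of_nonneg hy]

lemma planeMap_quadrant_two {a b x y : ℝ} (hx : x ≤ 0) (hy : 0 ≤ y) :
    planeMap a b (x, y) = (-x - y + a, x - y + b) := by
  rw [planeMap, abs_of_nonpos hx, abs_of_nonneg hy]

lemma planeMap_quadrant_three {a b x y : ℝ} (hx : x ≤ 0) (hy : y ≤ 0) :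
    planeMap a b (x, y) = (-x - y + a, x + y + b) := by
  rw [planeMap, abs_of_nonpos hx, abs_of_nonpos hy, sub_neg_eq_add]

lemma planeMap_quadrant_four {a b x y : ℝ} (hx : 0 ≤ x) (hy : y ≤ 0) :
    planeMap a b (x, y) = (x - y + a, x + y + b) := by
  rw [planeMap, abs_of_nonneg hx, abs_of_nonpos hy, sub_neg_eq_add]

/-- The part of the line `y = m x + k` over the interval `[x₀, x₁]`. -/
def lineOver (m k x₀ x₁ : ℝ) : Set (ℝ × ℝ) := (fun x => (x, m * x + k)) '' Icc x₀ x₁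

lemma segment_eq_lineOver (m k : ℝ) {x₀ x₁ : ℝ} (h : x₀ ≤ x₁) :
    segment ℝ (x₀, m * x₀ + k) (x₁, m * x₁ + k) = lineOver m k x₀ x₁ := by
  let f : ℝ →ᵃ[ℝ] ℝ × ℝ := AffineMap.lineMap (0, k) (1, m + k)
  have hf : (fun x => (x, m * x + k)) = f := by
    ext x <;> simp [f, AffineMap.lineMap_apply, mul_comm m]
  rw [lineOver, ← segment_eq_Icc h, hf, image_segment, ← hf]

lemma mem_lineOver {m k x₀ x₁ x y : ℝ} :
    (x, y) ∈ lineOver m k x₀ x₁ ↔ y = m * x + k ∧ x₀ ≤ x ∧ x ≤ x₁ := by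
  simp only [lineOver, mem_image, mem_Icc, Prod.mk.injEq]
  exact ⟨fun ⟨_, hx, rfl, hy⟩ => ⟨hy.symm, hx⟩, fun ⟨hy, hx⟩ => ⟨x, hx, rfl, hy.symm⟩⟩

/-- An invariant graph of `planeMap (-1) c`, with edges on the lines `y = x + c + 1` (which contains
the image of the first quadrant), `y = -1`, `y = -x + c - 1`, `y = x + c - 1` and `y = 2 c - 1`. -/
def coreGraph (c : ℝ) : Set (ℝ × ℝ) :=
  lineOver 1 (c + 1) (-c - 2) (c - 2) ∪ (lineOver 0 (-1) (-c - 2) c ∪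
    (lineOver (-1) (c - 1) 0 (c + 2) ∪ (lineOver 1 (c - 1) 0 c ∪
      lineOver 0 (2 * c - 1) (c - 2) (c + 4))))

variable {c x y t : ℝ} {p : ℝ × ℝ}

lemma mem_coreGraph : (x, y) ∈ coreGraph c ↔
    (y = x + (c + 1) ∧ -c - 2 ≤ x ∧ x ≤ c - 2) ∨ (y = -1 ∧ -c - 2 ≤ x ∧ x ≤ c) ∨
    (y = -x + (c - 1) ∧ 0 ≤ x ∧ x ≤ c + 2) ∨ (y = x + (c - 1) ∧ 0 ≤ x ∧ x ≤ c) ∨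
    (y = 2 * c - 1 ∧ c - 2 ≤ x ∧ x ≤ c + 4) := by
  simp only [coreGraph, mem_union, mem_lineOver, one_mul, zero_mul, zero_add, neg_one_mul]

lemma isCompactGraph_coreGraph (hc : 0 ≤ c) : IsCompactGraph (coreGraph c) := by
  classical
  refine ⟨{((-c - 2, 1 * (-c - 2) + (c + 1)), (c - 2, 1 * (c - 2) + (c + 1))),
    ((-c - 2, 0 * (-c - 2) + -1), (c, 0 * c + -1)),
    ((0, -1 * 0 + (c - 1)), (c + 2, -1 * (c + 2) + (c - 1))),
    ((0, 1 * 0 + (c - 1)), (c, 1 * c + (c - 1))),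
    ((c - 2, 0 * (c - 2) + (2 * c - 1)), (c + 4, 0 * (c + 4) + (2 * c - 1)))}, ?_⟩
  simp only [Finset.set_biUnion_insert, Finset.set_biUnion_singleton]
  rw [segment_eq_lineOver _ _ (by linarith), segment_eq_lineOver _ _ (by linarith),
    segment_eq_lineOver _ _ (by linarith), segment_eq_lineOver _ _ (by linarith),
    segment_eq_lineOver _ _ (by linarith), coreGraph]

lemma coreGraph_nonempty (hc : 0 ≤ c) : (coreGraph c).Nonempty :=
  ⟨(0, -1), mem_coreGraph.2 (.inr (.inl ⟨rfl, by linarith, hc⟩))⟩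

lemma mapsTo_coreGraph (hc : 4 < c) : MapsTo (planeMap (-1) c) (coreGraph c) (coreGraph c) := by
  rintro ⟨x, y⟩ h
  rcases mem_coreGraph.1 h with ⟨rfl, hl, -⟩ | ⟨rfl, hl, hr⟩ | ⟨rfl, hl, hr⟩ | ⟨rfl, hl, -⟩ |
    ⟨rfl, hl, hr⟩
  · rcases le_total 0 x with hx | hx
    · rw [planeMap_quadrant_one hx (by linarith), mem_coreGraph]
      exact .inr (.inl ⟨by ring, by linarith, by linarith⟩)
    · rcases le_total 0 (x + (c + 1)) with hy | hy
      · rw [planeMap_quadrant_two hx hy, mem_coreGraph]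
        exact .inr (.inl ⟨by ring, by linarith, by linarith⟩)
      · rw [planeMap_quadrant_three hx hy, mem_coreGraph]
        exact .inr (.inr (.inl ⟨by ring, by linarith, by linarith⟩))
  · rcases le_total 0 x with hx | hx
    · rw [planeMap_quadrant_four hx (by norm_num), mem_coreGraph]
      exact .inr (.inr (.inr (.inl ⟨by ring, by linarith, by linarith⟩)))
    · rw [planeMap_quadrant_three hx (by norm_num), mem_coreGraph]
      exact .inr (.inr (.inl ⟨by ring, by linarith, by linarith⟩))
  · rcases le_total 0 (-x + (c - 1)) with hy | hy
    · rw [planeMap_quadrant_one hl hy, mem_coreGraph]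
      exact .inl ⟨by ring, by linarith, by linarith⟩
    · rw [planeMap_quadrant_four hl hy, mem_coreGraph]
      exact .inr (.inr (.inr (.inr ⟨by ring, by linarith, by linarith⟩)))
  · rw [planeMap_quadrant_one hl (by linarith), mem_coreGraph]
    exact .inl ⟨by ring, by linarith, by linarith⟩
  · rw [planeMap_quadrant_one (by linarith) (by linarith), mem_coreGraph]
    exact .inl ⟨by ring, by linarith, by linarith⟩

/-- The fixed point of `planeMap (-1) c` in the second quadrant. -/
noncomputable def repeller (c : ℝ) : ℝ × ℝ := ((-c - 2) / 5, (2 * c - 1) / 5)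

lemma isFixedPt_repeller (hc : 1 / 2 ≤ c) :
    Function.IsFixedPt (planeMap (-1) c) (repeller c) := by
  rw [Function.IsFixedPt, repeller, planeMap_quadrant_two (by linarith) (by linarith)]
  ext <;> ring

/-- The parametrization of the line `y = x + c + 1` that contains the image of the first
quadrant. -/
def linePoint (c t : ℝ) : ℝ × ℝ := (t - 1, t + c)

lemma planeMap_eq_linePoint (hx : 0 ≤ x) (hy : 0 ≤ y) :
    planeMap (-1) c (x, y) = linePoint c (x - y) :=
  planeMap_quadrant_one hx hy

lemma iterate_linePoint_of_le_neg (hc : 4 < c) (ht : t ≤ -c) :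
    (planeMap (-1) c)^[3] (linePoint c t) = linePoint c (-4 * t - 5 * c + 1) := by
  rw [Function.iterate_succ_apply, linePoint, planeMap_quadrant_three (by linarith) (by linarith),
    Function.iterate_succ_apply, planeMap_quadrant_four (by linarith) (by linarith),
    Function.iterate_one, planeMap_eq_linePoint (by linarith) (by linarith)]
  congr 1
  ring

/-- The orbit of `p` enters the core graph or ends at the repeller. -/
def IsAbsorbed (c : ℝ) (p : ℝ × ℝ) : Prop :=
  ∃ n : ℕ, (planeMap (-1) c)^[n] p ∈ coreGraph c ∪ {repeller c}

lemma IsAbsorbed.of_mem (h : p ∈ coreGraph c) : IsAbsorbed c p := ⟨0, .inl h⟩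

lemma IsAbsorbed.of_planeMap (h : IsAbsorbed c (planeMap (-1) c p)) : IsAbsorbed c p := by
  obtain ⟨n, hn⟩ := h
  exact ⟨n + 1, by rwa [Function.iterate_succ_apply]⟩

lemma IsAbsorbed.of_planeMap_eq {q : ℝ × ℝ} (hpq : planeMap (-1) c p = q) (h : IsAbsorbed c q) :
    IsAbsorbed c p :=
  .of_planeMap (hpq ▸ h)

lemma IsAbsorbed.of_iterate {k : ℕ} (h : IsAbsorbed c ((planeMap (-1) c)^[k] p)) :
    IsAbsorbed c p := by
  obtain ⟨n, hn⟩ := h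
  exact ⟨n + k, by rwa [Function.iterate_add_apply]⟩

lemma isAbsorbed_linePoint (hc : 4 < c) (t : ℝ) : IsAbsorbed c (linePoint c t) := by
  wlog ht : -c - 1 ≤ t generalizing t
  · refine .of_iterate (k := 3) ?_
    rw [iterate_linePoint_of_le_neg hc (by linarith)]
    exact this _ (by linarith)
  rcases le_total t 1 with ht₁ | ht₁
  · exact .of_mem (mem_coreGraph.2 (.inl ⟨by ring, by linarith, by linarith⟩))
  · refine .of_planeMap_eq (planeMap_quadrant_one (by linarith) (by linarith)) (.of_mem ?_)
    exact mem_coreGraph.2 (.inr (.inl ⟨by ring, by linarith, by linarith⟩))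

lemma isAbsorbed_quadrant_one (hc : 4 < c) (hx : 0 ≤ x) (hy : 0 ≤ y) : IsAbsorbed c (x, y) :=
  .of_planeMap_eq (planeMap_eq_linePoint hx hy) (isAbsorbed_linePoint hc _)

lemma isAbsorbed_quadrant_four_of_le (hc : 4 < c) (hx : 0 ≤ x) (hy : y ≤ 0) (hsub : 1 ≤ x - y)
    (hadd : -c ≤ x + y) : IsAbsorbed c (x, y) :=
  .of_planeMap_eq (planeMap_quadrant_four hx hy)
    (isAbsorbed_quadrant_one hc (by linarith) (by linarith))

lemma isAbsorbed_neg_mk (hc : 4 < c) (hy : y ≤ 1) : IsAbsorbed c (-c, y) := by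
  rcases le_total 0 y with hy₀ | hy₀
  · refine .of_planeMap_eq (planeMap_quadrant_two (by linarith) hy₀) ?_
    exact isAbsorbed_quadrant_four_of_le hc (by linarith) (by linarith) (by linarith) (by linarith)
  · refine .of_planeMap_eq (planeMap_quadrant_three (by linarith) hy₀) ?_
    exact isAbsorbed_quadrant_four_of_le hc (by linarith) (by linarith) (by linarith) (by linarith)

lemma isAbsorbed_quadrant_three (hc : 4 < c) (hx : x ≤ 0) (hy : y ≤ 0) : IsAbsorbed c (x, y) := by
  refine .of_planeMap_eq (planeMap_quadrant_three hx hy) ?_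
  rcases le_total 1 (-x - y) with hxy | hxy
  · rcases le_total 0 (x + y + c) with hy' | hy'
    · exact isAbsorbed_quadrant_one hc (by linarith) hy'
    · exact isAbsorbed_quadrant_four_of_le hc (by linarith) hy' (by linarith) (by linarith)
  · have hstep : planeMap (-1) c (-x - y + -1, x + y + c) = (-c, -2 * (x + y) - 1) := by
      rw [planeMap_quadrant_two (by linarith) (by linarith)]
      ext <;> ring
    exact .of_planeMap_eq hstep (isAbsorbed_neg_mk hc (by linarith))

lemma isAbsorbed_quadrant_four (hc : 4 < c) (hx : 0 ≤ x) (hy : y ≤ 0) : IsAbsorbed c (x, y) := by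
  refine .of_planeMap_eq (planeMap_quadrant_four hx hy) ?_
  rcases le_total 1 (x - y) with hxy | hxy
  · rcases le_total 0 (x + y + c) with hy' | hy'
    · exact isAbsorbed_quadrant_one hc (by linarith) hy'
    · exact isAbsorbed_quadrant_four_of_le hc (by linarith) hy' (by linarith) (by linarith)
  have hstep : planeMap (-1) c (x - y + -1, x + y + c) = (-2 * x - c, -2 * y - 1) := by
    rw [planeMap_quadrant_two (by linarith) (by linarith)]
    ext <;> ring
  refine .of_planeMap_eq hstep ?_
  rcases le_total (-2 * y - 1) 0 with hy' | hy'
  · exact isAbsorbed_quadrant_three hc (by linarith) hy'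
  refine .of_planeMap_eq (planeMap_quadrant_two (by linarith) hy') ?_
  rcases le_total 0 (-2 * x - c - (-2 * y - 1) + c) with hy'' | hy''
  · exact isAbsorbed_quadrant_one hc (by linarith) hy''
  · exact isAbsorbed_quadrant_four_of_le hc (by linarith) hy'' (by linarith) (by linarith)

lemma nonpos_of_forall_pow_mul_le {r u C : ℝ} (hr : 1 < r) (h : ∀ n : ℕ, r ^ n * u ≤ C) :
    u ≤ 0 := by
  by_contra! hu
  obtain ⟨n, hn⟩ := pow_unbounded_of_one_lt (C / u) hr
  exact (h n).not_gt ((div_lt_iff₀ hu).1 hn)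

lemma iterate_four_sub_repeller (h : ∀ n : ℕ, (planeMap (-1) c)^[n] p ∈ Iic 0 ×ˢ Ici 0) :
    (planeMap (-1) c)^[4] p - repeller c = (-4 : ℝ) • (p - repeller c) := by
  have hstep (n : ℕ) : (planeMap (-1) c)^[n + 1] p =
      (-((planeMap (-1) c)^[n] p).1 - ((planeMap (-1) c)^[n] p).2 + -1,
        ((planeMap (-1) c)^[n] p).1 - ((planeMap (-1) c)^[n] p).2 + c) := by
    rw [Function.iterate_succ_apply']
    exact planeMap_quadrant_two (h n).1 (h n).2
  rw [hstep 3, hstep 2, hstep 1, hstep 0]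
  ext <;> simp only [repeller, Function.iterate_zero, id, Prod.fst_sub, Prod.snd_sub,
    Prod.smul_fst, Prod.smul_snd, smul_eq_mul] <;> ring

lemma iterate_mem_of_forall_iterate_mem {X : Type*} {T : X → X} {A : Set X} {x : X}
    (h : ∀ n : ℕ, T^[n] x ∈ A) (m n : ℕ) : T^[n] (T^[m] x) ∈ A := by
  rw [← Function.iterate_add_apply]
  exact h _

lemma iterate_eight_mul_sub_repeller (h : ∀ n : ℕ, (planeMap (-1) c)^[n] p ∈ Iic 0 ×ˢ Ici 0)
    (n : ℕ) : (planeMap (-1) c)^[8 * n] p - repeller c = (16 : ℝ) ^ n • (p - repeller c) := by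
  induction n with
  | zero => simp
  | succ n ih =>
    have hmem := iterate_mem_of_forall_iterate_mem h
    rw [show 8 * (n + 1) = 4 + (4 + 8 * n) by ring, Function.iterate_add_apply,
      iterate_four_sub_repeller (hmem _), Function.iterate_add_apply,
      iterate_four_sub_repeller (hmem _), ih, smul_smul, smul_smul, pow_succ']
    norm_num

lemma le_repeller_of_forall_iterate_mem (h : ∀ n : ℕ, (planeMap (-1) c)^[n] p ∈ Iic 0 ×ˢ Ici 0) :
    p.1 ≤ (repeller c).1 ∧ (repeller c).2 ≤ p.2 := by
  have hpow := iterate_eight_mul_sub_repeller h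
  have hfst : p.1 - (repeller c).1 ≤ 0 :=
    nonpos_of_forall_pow_mul_le (C := -(repeller c).1) (by norm_num : (1 : ℝ) < 16) fun n => by
      have := (congrArg Prod.fst (hpow n)).symm.le
      have : ((planeMap (-1) c)^[8 * n] p).1 ≤ 0 := (h (8 * n)).1
      simp only [Prod.fst_sub, Prod.smul_fst, smul_eq_mul] at *
      linarith
  have hsnd : (repeller c).2 - p.2 ≤ 0 :=
    nonpos_of_forall_pow_mul_le (C := (repeller c).2) (by norm_num : (1 : ℝ) < 16) fun n => by
      have := (congrArg Prod.snd (hpow n)).le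
      have : 0 ≤ ((planeMap (-1) c)^[8 * n] p).2 := (h (8 * n)).2
      simp only [Prod.snd_sub, Prod.smul_snd, smul_eq_mul] at *
      linarith
  exact ⟨sub_nonpos.1 hfst, sub_nonpos.1 hsnd⟩

/-- The fourth iterate reverses directions at the repeller, so the one-sided bounds on `p` and on
its fourth image force equality. -/
lemma eq_repeller_of_forall_iterate_mem
    (h : ∀ n : ℕ, (planeMap (-1) c)^[n] p ∈ Iic 0 ×ˢ Ici 0) : p = repeller c := by
  obtain ⟨hfst, hsnd⟩ := le_repeller_of_forall_iterate_mem h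
  obtain ⟨hfst₄, hsnd₄⟩ :=
    le_repeller_of_forall_iterate_mem (iterate_mem_of_forall_iterate_mem h 4)
  have hfour := iterate_four_sub_repeller h
  have hfst' := congrArg Prod.fst hfour
  have hsnd' := congrArg Prod.snd hfour
  simp only [Prod.fst_sub, Prod.snd_sub, Prod.smul_fst, Prod.smul_snd, smul_eq_mul] at hfst' hsnd'
  ext <;> linarith

lemma isAbsorbed (hc : 4 < c) (p : ℝ × ℝ) : IsAbsorbed c p := by
  by_contra hp
  have hQ₂ (n : ℕ) : (planeMap (-1) c)^[n] p ∈ Iic 0 ×ˢ Ici 0 := by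
    have hn : ¬IsAbsorbed c ((planeMap (-1) c)^[n] p) := mt IsAbsorbed.of_iterate hp
    generalize (planeMap (-1) c)^[n] p = z at hn ⊢
    obtain ⟨x, y⟩ := z
    contrapose! hn
    rcases le_total 0 x with hx | hx <;> rcases le_total 0 y with hy | hy
    exacts [isAbsorbed_quadrant_one hc hx hy, isAbsorbed_quadrant_four hc hx hy,
      (hn ⟨hx, hy⟩).elim, isAbsorbed_quadrant_three hc hx hy]
  exact hp ⟨0, .inr (eq_repeller_of_forall_iterate_mem hQ₂)⟩

theorem isInvariantGraph_coreGraph (hc : 4 < c) : IsInvariantGraph (-1) c (coreGraph c) where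
  graph := isCompactGraph_coreGraph (by linarith)
  nonempty := coreGraph_nonempty (by linarith)
  invariant := mapsTo_coreGraph hc
  absorbing := ⟨{repeller c}, finite_singleton _, singleton_subset_iff.2
    (Function.mk_mem_periodicPts one_pos ((isFixedPt_repeller (by linarith)).isPeriodicPt 1)),
    isAbsorbed hc⟩

end CoreGraph

/-! ### Itineraries near `c = 8` -/

section NearEight

lemma quadrant_one {x y : ℝ} (hx : 0 ≤ x) (hy : 0 ≤ y) : quadrant (x, y) = (true, true) := by
  simp [quadrant, hx, hy]

lemma quadrant_two {x y : ℝ} (hx : x < 0) (hy : 0 ≤ y) : quadrant (x, y) = (false, true) := by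
  simp [quadrant, hx, hy]

lemma quadrant_three {x y : ℝ} (hx : x < 0) (hy : y < 0) : quadrant (x, y) = (false, false) := by
  simp [quadrant, hx, hy]

lemma quadrant_four {x y : ℝ} (hx : 0 ≤ x) (hy : y < 0) : quadrant (x, y) = (true, false) := by
  simp [quadrant, hx, hy]

variable {c t u x : ℝ}

lemma planeMap_linePoint_of_mem_Icc (ht : t ∈ Icc (-c) 1) :
    planeMap (-1) c (linePoint c t) = (-2 * t - c, -1) := by
  rw [linePoint, planeMap_quadrant_two (by linarith [ht.2]) (by linarith [ht.1])]
  ext <;> ring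

lemma planeMap_neg_one_of_nonneg (hx : 0 ≤ x) : planeMap (-1) c (x, -1) = (x, x + c - 1) := by
  rw [planeMap_quadrant_four hx (by norm_num)]
  ext <;> ring

lemma planeMap_neg_one_of_nonpos (hx : x ≤ 0) : planeMap (-1) c (x, -1) = (-x, x + c - 1) := by
  rw [planeMap_quadrant_three hx (by norm_num)]
  ext <;> ring

lemma iterate_linePoint_of_le_neg_half (hc : 4 < c) (ht : t ∈ Icc (-c) (-c / 2)) :
    (planeMap (-1) c)^[3] (linePoint c t) = linePoint c (1 - c) := by
  obtain ⟨hl, hr⟩ := ht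
  rw [Function.iterate_succ_apply, planeMap_linePoint_of_mem_Icc ⟨hl, by linarith⟩,
    Function.iterate_succ_apply, planeMap_neg_one_of_nonneg (by linarith),
    Function.iterate_one, planeMap_eq_linePoint (by linarith) (by linarith)]
  congr 1
  ring

lemma itinerary_linePoint_of_le_neg_half (hc : 4 < c) (ht : t ∈ Icc (-c) (-c / 2)) :
    (fun k : Fin 3 => itinerary (planeMap (-1) c) quadrant (linePoint c t) k) =
      ![(false, true), (true, false), (true, true)] := by
  obtain ⟨hl, hr⟩ := ht
  have hone := planeMap_linePoint_of_mem_Icc (c := c) (t := t) ⟨hl, by linarith⟩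
  have htwo := planeMap_neg_one_of_nonneg (c := c) (x := -2 * t - c) (by linarith)
  ext1 k
  fin_cases k
  · exact quadrant_two (by linarith) (by linarith)
  · exact (congrArg quadrant hone).trans (quadrant_four (by linarith) (by norm_num))
  · exact (congrArg quadrant ((congrArg _ hone).trans htwo)).trans
      (quadrant_one (by linarith) (by linarith))

/-- The parameter of the point of the line `y = x + c + 1` that has period three and whose orbit
visits the second, third and first quadrants. -/
noncomputable def saddle (c : ℝ) : ℝ := -(c + 1) / 3

lemma iterate_linePoint_saddle_add (hc : 4 < c) (hu : -c / 2 ≤ saddle c + u)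
    (hu' : saddle c + u ≤ -1 / 2) :
    (planeMap (-1) c)^[3] (linePoint c (saddle c + u)) = linePoint c (saddle c + 4 * u) := by
  rw [Function.iterate_succ_apply, planeMap_linePoint_of_mem_Icc ⟨by linarith, by linarith⟩,
    Function.iterate_succ_apply, planeMap_neg_one_of_nonpos (by linarith),
    Function.iterate_one, planeMap_eq_linePoint (by linarith) (by linarith), saddle]
  congr 1
  ring

lemma itinerary_linePoint_of_neg_half_lt (hc : 4 < c) (ht : -c / 2 < t) (ht' : t ≤ -1 / 2) :
    (fun k : Fin 3 => itinerary (planeMap (-1) c) quadrant (linePoint c t) k) =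
      ![(false, true), (false, false), (true, true)] := by
  have hone := planeMap_linePoint_of_mem_Icc (c := c) (t := t) ⟨by linarith, by linarith⟩
  have htwo := planeMap_neg_one_of_nonpos (c := c) (x := -2 * t - c) (by linarith)
  ext1 k
  fin_cases k
  · exact quadrant_two (by linarith) (by linarith)
  · exact (congrArg quadrant hone).trans (quadrant_three (by linarith) (by norm_num))
  · exact (congrArg quadrant ((congrArg _ hone).trans htwo)).trans
      (quadrant_one (by linarith) (by linarith))

lemma iterate_linePoint_of_neg_half_le (hc : 4 < c) (ht : t ∈ Icc (-1 / 2) 1) :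
    (planeMap (-1) c)^[4] (linePoint c t) = linePoint c (4 * t - c + 1) := by
  obtain ⟨hl, hr⟩ := ht
  rw [Function.iterate_succ_apply, planeMap_linePoint_of_mem_Icc ⟨by linarith, hr⟩,
    Function.iterate_succ_apply, planeMap_neg_one_of_nonpos (by linarith),
    Function.iterate_succ_apply, planeMap_quadrant_four (by linarith) (by linarith),
    Function.iterate_one, planeMap_eq_linePoint (by linarith) (by linarith)]
  congr 1
  ring

lemma iterate_linePoint_of_one_le (hc : 4 < c) (ht : 1 ≤ t) :
    (planeMap (-1) c)^[4] (linePoint c t) = linePoint c (5 - c) := by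
  rw [Function.iterate_succ_apply, linePoint, planeMap_quadrant_one (by linarith) (by linarith),
    Function.iterate_succ_apply, planeMap_quadrant_three (by linarith) (by linarith),
    Function.iterate_succ_apply, planeMap_quadrant_four (by linarith) (by linarith),
    Function.iterate_one, planeMap_eq_linePoint (by linarith) (by linarith)]
  congr 1
  ring

/-- The number of times `k < n` at which the itinerary of `x` fails to repeat itself after three
steps. -/
noncomputable def periodThreeDefects (c : ℝ) (x : ℝ × ℝ) (n : ℕ) : ℕ :=
  visits (planeMap (-1) c) (deviationSet (planeMap (-1) c) quadrant 3) x n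

lemma periodThreeDefects_le_add (c : ℝ) (x : ℝ × ℝ) (m n : ℕ) :
    periodThreeDefects c x n ≤ m + periodThreeDefects c ((planeMap (-1) c)^[m] x) n :=
  (visits_le_visits_add ..).trans (Nat.add_le_add_right (visits_le ..) _)

lemma periodThreeDefects_of_le_neg_half (hc : 4 < c) (ht : t ∈ Icc (-c) (-c / 2)) (n : ℕ) :
    periodThreeDefects c (linePoint c t) n = 0 := by
  refine Nat.le_zero.1 (visits_le_of_forall_exists_free_return
    (R := linePoint c '' Icc (-c) (-c / 2)) ?_ (mem_image_of_mem _ ht) n)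
  rintro _ ⟨s, hs, rfl⟩
  have hone : 1 - c ∈ Icc (-c) (-c / 2) := ⟨by linarith, by linarith⟩
  have hiter := iterate_linePoint_of_le_neg_half hc hs
  refine .inr ⟨3, three_pos, hiter ▸ mem_image_of_mem _ hone, ?_⟩
  rw [visits_deviationSet_eq_zero_iff, hiter, itinerary_linePoint_of_le_neg_half hc hone,
    itinerary_linePoint_of_le_neg_half hc hs]

lemma periodThreeDefects_saddle_add_three (hc : 4 < c) (hu : -c / 2 < saddle c + u)
    (hu' : saddle c + u ≤ -1 / 2) (hfour : -c / 2 < saddle c + 4 * u)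
    (hfour' : saddle c + 4 * u ≤ -1 / 2) :
    periodThreeDefects c (linePoint c (saddle c + u)) 3 = 0 := by
  rw [periodThreeDefects, visits_deviationSet_eq_zero_iff,
    iterate_linePoint_saddle_add hc hu.le hu', itinerary_linePoint_of_neg_half_lt hc hu hu',
    itinerary_linePoint_of_neg_half_lt hc hfour hfour']

/-- To the left of the saddle the orbit moves away from it until the parameter is at most `-c / 2`,
after which there are no more defects. -/
lemma periodThreeDefects_saddle_add_of_nonpos (hc : 4 < c) (hu : -c / 2 < saddle c + u)
    (hu₀ : u ≤ 0) (n : ℕ) :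
    periodThreeDefects c (linePoint c (saddle c + u)) n ≤ 3 := by
  refine visits_le_of_forall_exists_free_return
    (R := (fun u => linePoint c (saddle c + u)) '' {u | -c / 2 < saddle c + u ∧ u ≤ 0}) ?_
    ⟨u, ⟨hu, hu₀⟩, rfl⟩ n
  rintro _ ⟨v, ⟨hv, hv₀⟩, rfl⟩
  have hsaddle : saddle c = -(c + 1) / 3 := rfl
  have hiter := iterate_linePoint_saddle_add hc hv.le (by linarith)
  rcases le_or_gt (saddle c + 4 * v) (-c / 2) with hfour | hfour
  · refine .inl fun n => (periodThreeDefects_le_add c _ 3 n).trans ?_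
    rw [hiter, periodThreeDefects_of_le_neg_half hc ⟨by linarith, hfour⟩]
  · exact .inr ⟨3, three_pos, hiter ▸ ⟨4 * v, ⟨hfour, by linarith⟩, rfl⟩,
      periodThreeDefects_saddle_add_three hc hv (by linarith) hfour (by linarith)⟩

lemma iterate_linePoint_saddle_add_and_periodThreeDefects (hc : 4 < c) (hu : 0 ≤ u) {j : ℕ}
    (hj : saddle c + 4 ^ j * u ≤ -1 / 2) :
    (planeMap (-1) c)^[3 * j] (linePoint c (saddle c + u)) = linePoint c (saddle c + 4 ^ j * u) ∧
      periodThreeDefects c (linePoint c (saddle c + u)) (3 * j) = 0 := by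
  have hsaddle : saddle c = -(c + 1) / 3 := rfl
  induction j with
  | zero => simp [periodThreeDefects, visits]
  | succ j ih =>
    have hv : 0 ≤ 4 ^ j * u := by positivity
    rw [pow_succ', mul_assoc] at hj ⊢
    obtain ⟨hiter, hzero⟩ := ih (by linarith)
    constructor
    · rw [mul_add_one, add_comm, Function.iterate_add_apply, hiter,
        iterate_linePoint_saddle_add hc (by linarith) (by linarith)]
    · have hthree := periodThreeDefects_saddle_add_three hc (u := 4 ^ j * u) (by linarith)
        (by linarith) (by linarith) hj
      rw [periodThreeDefects] at hzero hthree ⊢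
      rw [mul_add_one, visits_add, hiter, hzero, hthree]

/-- The part of the line `y = x + c + 1` to which the orbits that leave a neighbourhood of the
saddle on its right come back. -/
def returnSet (c : ℝ) : Set (ℝ × ℝ) := linePoint c '' Icc (-c) (5 - c)

lemma iterate_linePoint_mem_returnSet (hc : 4 < c) (ht : t ∈ Icc (-c - 1) (-c)) :
    (planeMap (-1) c)^[3] (linePoint c t) ∈ returnSet c := by
  rw [iterate_linePoint_of_le_neg hc ht.2]
  exact mem_image_of_mem _ ⟨by linarith [ht.2], by linarith [ht.1]⟩

lemma exists_iterate_linePoint_mem_returnSet (hc : 4 < c) (ht : -1 / 2 ≤ t) :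
    ∃ k ≤ 7, (planeMap (-1) c)^[k] (linePoint c t) ∈ returnSet c := by
  obtain ⟨s, hs, hiter⟩ : ∃ s ∈ Icc (-c - 1) (5 - c),
      (planeMap (-1) c)^[4] (linePoint c t) = linePoint c s := by
    rcases le_total t 1 with ht' | ht'
    · exact ⟨_, ⟨by linarith, by linarith⟩, iterate_linePoint_of_neg_half_le hc ⟨ht, ht'⟩⟩
    · exact ⟨_, ⟨by linarith, le_rfl⟩, iterate_linePoint_of_one_le hc ht'⟩
  rcases le_total s (-c) with hs' | hs'
  · refine ⟨3 + 4, le_rfl, ?_⟩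
    rw [Function.iterate_add_apply, hiter]
    exact iterate_linePoint_mem_returnSet hc ⟨hs.1, hs'⟩
  · exact ⟨4, by norm_num, hiter ▸ mem_image_of_mem _ ⟨hs', hs.2⟩⟩

lemma exists_iterate_saddle_add_mem_returnSet (hc : 7 < c) (hu : 0 < u)
    (hu' : saddle c + u ≤ -1 / 2) :
    ∃ m, (planeMap (-1) c)^[m] (linePoint c (saddle c + u)) ∈ returnSet c ∧
      periodThreeDefects c (linePoint c (saddle c + u)) m ≤ 10 ∧
      ∀ N : ℕ, 4 ^ N * u ≤ 2 → 3 * N ≤ m := by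
  have hsaddle : saddle c = -(c + 1) / 3 := rfl
  obtain ⟨j, hj, hj'⟩ := exists_nat_pow_near (x := (-1 / 2 - saddle c) / u) (y := 4)
    ((one_le_div hu).2 (by linarith)) (by norm_num)
  rw [le_div_iff₀ hu] at hj
  rw [div_lt_iff₀ hu, pow_succ', mul_assoc] at hj'
  obtain ⟨hiter, hzero⟩ :=
    iterate_linePoint_saddle_add_and_periodThreeDefects (c := c) (j := j) (by linarith) hu.le
      (by linarith)
  obtain ⟨k, hk, hmem⟩ := exists_iterate_linePoint_mem_returnSet (c := c) (by linarith)
    (t := saddle c + 4 * (4 ^ j * u)) (by linarith)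
  refine ⟨3 * j + (3 + k), ?_, ?_, fun N hN => ?_⟩
  · rw [add_comm, add_comm 3 k, Function.iterate_add_apply, hiter, Function.iterate_add_apply,
      iterate_linePoint_saddle_add (by linarith) (by linarith) (by linarith)]
    exact hmem
  · rw [periodThreeDefects, visits_add, ← periodThreeDefects, hzero, zero_add]
    exact (visits_le ..).trans (by lia)
  · have hlt : 4 ^ N * u < 4 ^ (j + 1) * u := by
      rw [pow_succ', mul_assoc]
      linarith
    have := (pow_lt_pow_iff_right₀ (by norm_num : (1 : ℝ) < 4)).1 (lt_of_mul_lt_mul_right hlt hu.le)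
    lia

variable {δ : ℝ} {N : ℕ}

lemma periodThreeDefects_le_of_mem_returnSet (hc : 7 < c)
    (hcN : 4 ^ N * (2 * (8 - c) / 3) ≤ 2) (hδ : 10 ≤ 3 * N * δ) {p : ℝ × ℝ}
    (hp : p ∈ returnSet c) (n : ℕ) : (periodThreeDefects c p n : ℝ) ≤ δ * n + 10 := by
  have hsaddle : saddle c = -(c + 1) / 3 := rfl
  have hN : 0 < N := Nat.pos_of_ne_zero fun h => by norm_num [h] at hδ
  have hδ₀ : 0 ≤ δ := (pos_of_mul_pos_right (by linarith : 0 < 3 * N * δ) (by positivity)).le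
  refine visits_le_of_forall_exists_return (B := 10) hδ₀ ?_ hp n
  rintro _ ⟨t, ⟨ht, ht'⟩, rfl⟩
  obtain ⟨u, rfl⟩ : ∃ u, t = saddle c + u := ⟨_, (add_sub_cancel _ _).symm⟩
  rcases le_or_gt (saddle c + u) (-c / 2) with htrap | htrap
  · exact .inl fun n =>
      (periodThreeDefects_of_le_neg_half (by linarith) ⟨ht, htrap⟩ n).trans_le (by norm_num)
  rcases le_or_gt u 0 with hu | hu
  · exact .inl fun n => (periodThreeDefects_saddle_add_of_nonpos (by linarith) htrap hu n).trans
      (by norm_num)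
  obtain ⟨m, hmem, hm, hmN⟩ := exists_iterate_saddle_add_mem_returnSet hc hu (by linarith)
  have hNm : 3 * N ≤ m :=
    hmN N ((mul_le_mul_of_nonneg_left (by linarith) (by positivity)).trans hcN)
  have hNm' : (3 * N : ℝ) ≤ m := by exact_mod_cast hNm
  refine .inr ⟨m, by lia, hmem, hm, ?_⟩
  calc (periodThreeDefects c (linePoint c (saddle c + u)) m : ℝ) ≤ 10 := by exact_mod_cast hm
    _ ≤ 3 * N * δ := hδ
    _ ≤ m * δ := by gcongr
    _ = δ * m := mul_comm _ _

lemma periodThreeDefects_linePoint_le (hc : 7 < c) (hcN : 4 ^ N * (2 * (8 - c) / 3) ≤ 2)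
    (hδ : 10 ≤ 3 * N * δ) (ht : -c - 1 ≤ t) (n : ℕ) :
    (periodThreeDefects c (linePoint c t) n : ℝ) ≤ δ * n + 20 := by
  have hδ₀ : 0 ≤ δ := (pos_of_mul_pos_right (by linarith : 0 < 3 * N * δ) (by positivity)).le
  have hδn : 0 ≤ δ * n := by positivity
  have hreturn {m : ℕ} (hmem : (planeMap (-1) c)^[m] (linePoint c t) ∈ returnSet c)
      (hm : periodThreeDefects c (linePoint c t) m ≤ 10) :
      (periodThreeDefects c (linePoint c t) n : ℝ) ≤ δ * n + 20 := by
    have hle : periodThreeDefects c (linePoint c t) n ≤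
        10 + periodThreeDefects c ((planeMap (-1) c)^[m] (linePoint c t)) n :=
      (visits_le_visits_add ..).trans (Nat.add_le_add_right hm _)
    have hle' : (periodThreeDefects c (linePoint c t) n : ℝ) ≤
        10 + periodThreeDefects c ((planeMap (-1) c)^[m] (linePoint c t)) n := by
      exact_mod_cast hle
    linarith [periodThreeDefects_le_of_mem_returnSet hc hcN hδ hmem n]
  rcases le_total t (-c) with hlow | hlow
  · exact hreturn (iterate_linePoint_mem_returnSet (by linarith) ⟨by linarith, hlow⟩)
      ((visits_le ..).trans (by norm_num))
  rcases le_total (-1 / 2) t with hhigh | hhigh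
  · obtain ⟨k, hk, hmem⟩ := exists_iterate_linePoint_mem_returnSet (c := c) (by linarith) hhigh
    exact hreturn hmem ((visits_le ..).trans (hk.trans (by norm_num)))
  rcases le_or_gt t (-c / 2) with htrap | htrap
  · rw [periodThreeDefects_of_le_neg_half (by linarith) ⟨hlow, htrap⟩, Nat.cast_zero]
    positivity
  obtain ⟨u, rfl⟩ : ∃ u, t = saddle c + u := ⟨_, (add_sub_cancel _ _).symm⟩
  rcases le_or_gt u 0 with hu | hu
  · have hle : (periodThreeDefects c (linePoint c (saddle c + u)) n : ℝ) ≤ 3 := by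
      exact_mod_cast periodThreeDefects_saddle_add_of_nonpos (by linarith) htrap hu n
    linarith
  · obtain ⟨m, hmem, hm, -⟩ := exists_iterate_saddle_add_mem_returnSet hc hu hhigh
    exact hreturn hmem hm

lemma exists_iterate_antidiagonal_eq_linePoint (hc : 4 < c) (hx : 0 ≤ x) :
    ∃ k ≤ 2, ∃ t ≥ -c - 1, (planeMap (-1) c)^[k] (x, -x + (c - 1)) = linePoint c t := by
  rcases le_total 0 (-x + (c - 1)) with hy | hy
  · exact ⟨1, one_le_two, _, by linarith, planeMap_eq_linePoint hx hy⟩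
  · refine ⟨2, le_rfl, x - (-x + (c - 1)) + -1 - (x + (-x + (c - 1)) + c), by linarith, ?_⟩
    rw [Function.iterate_succ_apply, Function.iterate_one, planeMap_quadrant_four hx hy,
      planeMap_eq_linePoint (by linarith) (by linarith)]

lemma exists_iterate_eq_linePoint (hc : 4 < c) {p : ℝ × ℝ} (hp : p ∈ coreGraph c) :
    ∃ k ≤ 3, ∃ t ≥ -c - 1, (planeMap (-1) c)^[k] p = linePoint c t := by
  obtain ⟨x, y⟩ := p
  rcases mem_coreGraph.1 hp with ⟨rfl, hl, -⟩ | ⟨rfl, -⟩ | ⟨rfl, hl, -⟩ | ⟨rfl, hl, -⟩ |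
    ⟨rfl, hl, -⟩
  · refine ⟨0, by norm_num, x + 1, by linarith, ?_⟩
    rw [Function.iterate_zero_apply, linePoint]
    ext <;> ring
  · rcases le_total 0 x with hx | hx
    · refine ⟨2, by norm_num, x - (x + c - 1), by linarith, ?_⟩
      rw [Function.iterate_succ_apply, Function.iterate_one, planeMap_neg_one_of_nonneg hx,
        planeMap_eq_linePoint hx (by linarith)]
    · obtain ⟨k, hk, t, ht, hiter⟩ :=
        exists_iterate_antidiagonal_eq_linePoint hc (x := -x) (by linarith)
      refine ⟨k + 1, by lia, t, ht, ?_⟩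
      rw [Function.iterate_succ_apply, planeMap_neg_one_of_nonpos hx, ← hiter, neg_neg,
        add_sub_assoc]
  · obtain ⟨k, hk, h⟩ := exists_iterate_antidiagonal_eq_linePoint hc hl
    exact ⟨k, by lia, h⟩
  · exact ⟨1, by norm_num, _, by linarith, planeMap_eq_linePoint hl (by linarith)⟩
  · exact ⟨1, by norm_num, _, by linarith, planeMap_eq_linePoint (by linarith) (by linarith)⟩

lemma eventually_periodThreeDefects_le (hδ : 0 < δ) :
    ∀ᶠ c in 𝓝 (8 : ℝ), ∀ p ∈ coreGraph c, ∀ n,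
      (periodThreeDefects c p n : ℝ) ≤ δ * n + 23 := by
  obtain ⟨N, hN⟩ := exists_nat_ge (10 / (3 * δ))
  have hNδ : 10 ≤ 3 * N * δ := by
    rw [div_le_iff₀ (by positivity)] at hN
    linarith
  have hcont : Continuous fun c : ℝ => (4 : ℝ) ^ N * (2 * (8 - c) / 3) := by fun_prop
  filter_upwards [hcont.continuousAt.eventually_lt (continuousAt_const (y := 2)) (by norm_num),
    lt_mem_nhds (by norm_num : (7 : ℝ) < 8)] with c hcN hc p hp n
  obtain ⟨k, hk, t, ht, hiter⟩ := exists_iterate_eq_linePoint (by linarith) hp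
  have hle : (periodThreeDefects c p n : ℝ) ≤ 3 + periodThreeDefects c (linePoint c t) n := by
    exact_mod_cast hiter ▸
      (periodThreeDefects_le_add c p k n).trans (Nat.add_le_add_right hk _)
  linarith [periodThreeDefects_linePoint_le hc hcN.le hNδ ht n]

end NearEight

/-! ### The entropy function -/

section EntropyFunction

variable {a b c r : ℝ} {Γ Γ' : Set (ℝ × ℝ)}

lemma continuous_planeMap (a b : ℝ) : Continuous (planeMap a b) := by
  unfold planeMap
  fun_prop

lemma finite_biUnion_orbit {X : Type*} {T : X → X} {E : Set X} (hE : E.Finite)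
    (hper : E ⊆ Function.periodicPts T) : (⋃ e ∈ E, range fun n : ℕ => T^[n] e).Finite := by
  refine hE.biUnion fun e he => ?_
  obtain ⟨k, hk, hke⟩ := hper he
  refine ((finite_Iio k).image fun n => T^[n] e).subset ?_
  rintro _ ⟨n, rfl⟩
  exact ⟨n % k, Nat.mod_lt _ hk, hke.iterate_mod_apply n⟩

lemma mapsTo_biUnion_orbit {X : Type*} (T : X → X) (E : Set X) :
    MapsTo T (⋃ e ∈ E, range fun n : ℕ => T^[n] e) (⋃ e ∈ E, range fun n : ℕ => T^[n] e) := by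
  intro x hx
  obtain ⟨e, he, n, rfl⟩ := mem_iUnion₂.1 hx
  exact mem_iUnion₂.2 ⟨e, he, n + 1, Function.iterate_succ_apply' ..⟩

lemma IsInvariantGraph.coverEntropy_le (h : IsInvariantGraph a b Γ)
    (h' : IsInvariantGraph a b Γ') :
    Dynamics.coverEntropy (planeMap a b) Γ ≤ Dynamics.coverEntropy (planeMap a b) Γ' := by
  obtain ⟨E, hE, hper, habs⟩ := h'.absorbing
  let O := ⋃ e ∈ E, range fun n : ℕ => (planeMap a b)^[n] e
  have hEO : E ⊆ O := fun e he => mem_iUnion₂.2 ⟨e, he, 0, rfl⟩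
  calc Dynamics.coverEntropy (planeMap a b) Γ
      ≤ Dynamics.coverEntropy (planeMap a b) (Γ' ∪ O) :=
        coverEntropy_le_of_forall_exists_iterate_mem (continuous_planeMap a b)
          h.graph.isCompact h.invariant (h'.invariant.union_union (mapsTo_biUnion_orbit _ E))
          fun x _ => (habs x).imp fun n hn => union_subset_union_right _ hEO hn
    _ = max (Dynamics.coverEntropy (planeMap a b) Γ') (Dynamics.coverEntropy (planeMap a b) O) :=
        Dynamics.coverEntropy_union
    _ ≤ Dynamics.coverEntropy (planeMap a b) Γ' :=
        max_le le_rfl ((coverEntropy_le_zero_of_finite (finite_biUnion_orbit hE hper) _).trans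
          (Dynamics.coverEntropy_nonneg _ h'.nonempty))

theorem IsInvariantGraph.coverEntropy_eq (h : IsInvariantGraph a b Γ)
    (h' : IsInvariantGraph a b Γ') :
    Dynamics.coverEntropy (planeMap a b) Γ = Dynamics.coverEntropy (planeMap a b) Γ' :=
  le_antisymm (h.coverEntropy_le h') (h'.coverEntropy_le h)

lemma semiconj_smul_planeMap (a b : ℝ) (hr : 0 ≤ r) :
    Function.Semiconj (r • ·) (planeMap a b) (planeMap (r * a) (r * b)) := by
  intro p
  ext <;> simp only [planeMap, Prod.smul_fst, Prod.smul_snd, smul_eq_mul, abs_mul,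
    abs_of_nonneg hr] <;> ring

lemma IsCompactGraph.smul (h : IsCompactGraph Γ) (r : ℝ) : IsCompactGraph ((r • ·) '' Γ) := by
  classical
  obtain ⟨S, rfl⟩ := h
  refine ⟨S.image fun s => (r • s.1, r • s.2), ?_⟩
  rw [image_iUnion₂, Finset.set_biUnion_finset_image]
  exact iUnion₂_congr fun s _ =>
    image_segment ℝ (LinearMap.lsmul ℝ (ℝ × ℝ) r).toAffineMap s.1 s.2

lemma IsInvariantGraph.smul (h : IsInvariantGraph a b Γ) (hr : 0 < r) :
    IsInvariantGraph (r * a) (r * b) ((r • ·) '' Γ) := by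
  have hsemi := semiconj_smul_planeMap a b hr.le
  refine ⟨h.graph.smul r, h.nonempty.image _, hsemi.mapsTo_image h.invariant, ?_⟩
  obtain ⟨E, hE, hper, habs⟩ := h.absorbing
  refine ⟨(r • ·) '' E, hE.image _, hsemi.mapsTo_periodicPts.mono_left hper |>.image_subset,
    fun x => ?_⟩
  obtain ⟨n, hn⟩ := habs (r⁻¹ • x)
  refine ⟨n, ?_⟩
  have hiter := (hsemi.iterate_right n) (r⁻¹ • x)
  rw [smul_inv_smul₀ hr.ne'] at hiter
  rw [← hiter, ← image_union]
  exact mem_image_of_mem _ hn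

lemma coverEntropy_smul (a b : ℝ) (Γ : Set (ℝ × ℝ)) (hr : 0 < r) :
    Dynamics.coverEntropy (planeMap (r * a) (r * b)) ((r • ·) '' Γ) =
      Dynamics.coverEntropy (planeMap a b) Γ := by
  refine le_antisymm (Dynamics.coverEntropy_image_le_of_uniformContinuous
    (semiconj_smul_planeMap a b hr.le) (uniformContinuous_const_smul r) Γ) ?_
  have hinv := Dynamics.coverEntropy_image_le_of_uniformContinuous
    (semiconj_smul_planeMap (r * a) (r * b) (inv_pos.2 hr).le)
    (uniformContinuous_const_smul r⁻¹) ((r • ·) '' Γ)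
  rw [image_image] at hinv
  simpa only [inv_smul_smul₀ hr.ne', image_id', inv_mul_cancel_left₀ hr.ne'] using hinv

lemma IsInvariantGraph.coe_toReal_coverEntropy (h : IsInvariantGraph a b Γ) :
    ((Dynamics.coverEntropy (planeMap a b) Γ).toReal : EReal) =
      Dynamics.coverEntropy (planeMap a b) Γ := by
  have hle := (isPiecewiseAffine_planeMap a b).coverEntropy_le_log_card h.graph h.invariant
  exact EReal.coe_toReal (hle.trans_lt (EReal.coe_lt_top _)).ne
    (EReal.bot_lt_zero.trans_le (Dynamics.coverEntropy_nonneg _ h.nonempty)).ne'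

open Classical in
/-- The common topological entropy of `planeMap (-1) c` on its invariant graphs, and `0` if there is
none. -/
noncomputable def graphEntropy (c : ℝ) : ℝ :=
  if h : ∃ Γ, IsInvariantGraph (-1) c Γ then
    (Dynamics.coverEntropy (planeMap (-1) c) h.choose).toReal else 0

lemma IsInvariantGraph.coverEntropy_eq_graphEntropy (h : IsInvariantGraph (-1) c Γ) :
    Dynamics.coverEntropy (planeMap (-1) c) Γ = (graphEntropy c : EReal) := by
  have hex : ∃ Γ, IsInvariantGraph (-1) c Γ := ⟨Γ, h⟩
  rw [graphEntropy, dif_pos hex, hex.choose_spec.coe_toReal_coverEntropy]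
  exact h.coverEntropy_eq hex.choose_spec

lemma eventually_graphEntropy_mem_Icc {ε : ℝ} (hε : 0 < ε) :
    ∀ᶠ c in 𝓝 (8 : ℝ), graphEntropy c ∈ Icc 0 ε := by
  obtain ⟨δ, hδ, hentropy⟩ := exists_forall_coverEntropy_le_of_visits_le (Bool × Bool) hε
  filter_upwards [eventually_periodThreeDefects_le hδ, lt_mem_nhds (by norm_num : (4 : ℝ) < 8)]
    with c hdefects hc
  have hΓ := isInvariantGraph_coreGraph hc
  have hle := hentropy (isPiecewiseAffine_planeMap (-1) c) hΓ.graph hΓ.invariant three_pos hdefects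
  have hnonneg := Dynamics.coverEntropy_nonneg (planeMap (-1) c) hΓ.nonempty
  rw [hΓ.coverEntropy_eq_graphEntropy] at hle hnonneg
  exact ⟨EReal.coe_nonneg.1 hnonneg, EReal.coe_le_coe_iff.1 hle⟩

lemma continuousAt_graphEntropy : ContinuousAt graphEntropy 8 := by
  rw [Metric.continuousAt_iff']
  intro ε hε
  have hmem := eventually_graphEntropy_mem_Icc (half_pos hε)
  filter_upwards [hmem] with c hc
  calc dist (graphEntropy c) (graphEntropy 8) ≤ ε / 2 - 0 :=
        Real.dist_le_of_mem_Icc hc hmem.self_of_nhds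
    _ < ε := by linarith

end EntropyFunction

/-- There is a well-defined entropy function `h` of `c = -b/a`: the invariant graphs exist for
`c > 4`, and on every invariant graph the topological entropy of the restricted map is `h c`.
This function is continuous at `c = 8`. -/
theorem mainTheorem1 :
    ∃ h : ℝ → ℝ,
      (∀ a b : ℝ, a < 0 → 4 < -b / a → ∃ Γ : Set (ℝ × ℝ), IsInvariantGraph a b Γ) ∧
      (∀ (a b : ℝ) (Γ : Set (ℝ × ℝ)), a < 0 → IsInvariantGraph a b Γ →
        Dynamics.coverEntropy (planeMap a b) Γ = ((h (-b / a) : ℝ) : EReal)) ∧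
      ContinuousAt h 8 := by
  refine ⟨graphEntropy, fun a b ha hc => ?_, fun a b Γ ha hΓ => ?_, continuousAt_graphEntropy⟩
  · have hgraph := (isInvariantGraph_coreGraph hc).smul (neg_pos.2 ha)
    rw [mul_neg_one, neg_neg, neg_mul, mul_div_cancel₀ _ ha.ne, neg_neg] at hgraph
    exact ⟨_, hgraph⟩
  · have hr : 0 < (-a)⁻¹ := inv_pos.2 (neg_pos.2 ha)
    have hgraph := hΓ.smul hr
    have hentropy := coverEntropy_smul a b Γ hr
    have hfst : (-a)⁻¹ * a = -1 := by rw [inv_neg, neg_mul, inv_mul_cancel₀ ha.ne]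
    have hsnd : (-a)⁻¹ * b = -b / a := by rw [inv_neg, neg_mul, neg_div, div_eq_inv_mul]
    rw [hfst, hsnd] at hgraph hentropy
    rw [← hentropy, hgraph.coverEntropy_eq_graphEntropy]
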